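/- Let $F=\mathbb H^2/\Gamma$ be a complete hyperbolic surface of finite type, possibly non-orientable, with at least one cusp, where $\Gamma\cong\pi_1(F)$ acts freely and properly discontinuously on $\mathbb H^2$ by isometries (Möbius or anti-Möbius maps); let $\pi:\mathbb H^2\to F$ be the universal covering. Let $\sigma$ be a lasso emanating from a cusp $p$: there is a unit-speed geodesic $\sigma:(-\infty,s_0]\to F$ emanating from $p$ (as $t\to-\infty$) such that $\sigma$ is injective on $(-\infty,s_0)$ and $\sigma(s_0)=\sigma(r_0)$ for some (necessarily unique) $r_0<s_0$. The point $q=\sigma(s_0)$ is the honda of $\sigma$. Both $2$-sided and $1$-sided lassos are allowed. Let $l_{pq}=\sigma((-\infty,r_0])$ be the geodesic segment of $\sigma$ from $p$ to its first visit of $q$. Normalise a lift $\widetilde\sigma_0$ of the geodesic containing $\sigma$ by an isometry so that it emanates from $\infty$ and lies on the line $\Re z=0$, and let $z_0$ be the lift on $\widetilde\sigma_0$ of the end point of $\sigma$. For $d\in\mathbb R$ let $\widetilde\sigma_d$ be the geodesic emanating from $\infty$ on the line $\Re z=d$. Then, for every sufficiently small $\epsilon>0$, each projected geodesic $\pi(\widetilde\sigma_d)$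 with $|d|<\epsilon$ has a first self-intersection point; let $z_d\in\widetilde\sigma_d$ be the lift of that point which is reached at the end of the corresponding lasso. The honda path of $\sigma$ is the curve $L=\{\pi(z_d):|d|<\epsilon\}$. The map $d\mapsto z_d$ is differentiable at $d=0$ with nonzero derivative, so $L$ has a tangent geodesic $T$ at $q$. Moreover, for every sufficiently small $\rho>0$ the following holds. Let $U(q)$ be the open metric disc of radius $\rho$ about $q$, and let $T_\rho$ be the open segment of $T$ of length $2\rho$ centred at $q$. Then $U(q)\setminus T_\rho$ has exactly two connected components $U_1(q)$ and $U_2(q)$, and $(l_{pq}\cap U(q))\setminus\{q\}$ and $(L\cap U(q))\setminus\{q\}$ are contained in the same one of them. -/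

import Mathlib

open scoped MatrixGroups UpperHalfPlane Topology

/-- A complete connected hyperbolic surface, orientable or not, presented by its universal covering:
a group `Γ` of isometries of the hyperbolic plane acting freely and properly discontinuously.
The isometry group of `ℍ` is `PGL(2, ℝ)`, where the classes of positive determinant act by Möbius
transformations and those of negative determinant by anti-Möbius transformations; `Γ` is the
group of deck transformations, and the surface is the quotient of `ℍ` by `Γ`. -/
structure HyperbolicSurface where
  /-- the group of deck transformations, a copy of the fundamental group -/
  Γ : Subgroup PGL(2, ℝ)
  properlyDiscontinuous : ProperlyDiscontinuousSMul Γ ℍ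
  free : ∀ γ ∈ Γ, ∀ z : ℍ, γ • z = z → γ = 1

/-- The geodesic of `ℍ` on the vertical line `re = x`, parametrized by arc length and running
downwards from the ideal point `∞` (reached as `t → -∞`). -/
noncomputable def verticalGeodesic (x t : ℝ) : ℍ :=
  UpperHalfPlane.mk ⟨x, Real.exp (-t)⟩ (Real.exp_pos _)

/-- Complete geodesics of `ℍ` parametrized by arc length: the images under isometries of the
downward imaginary axis. -/
def IsGeodesic (τ : ℝ → ℍ) : Prop :=
  ∃ g : GL (Fin 2) ℝ, ∀ t, τ t = g • verticalGeodesic 0 t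

/-- The geodesics of `ℍ` emanating from the ideal point `g • ∞`, parametrized by arc length.
As `x` runs over `ℝ` these are all of them, `x` being the initial direction. -/
noncomputable def geodesicFrom (g : GL (Fin 2) ℝ) (x t : ℝ) : ℍ :=
  g • verticalGeodesic x t

/-- `τ` (based at `τ 0`) is the geodesic tangent to the path `z` at `z 0`; the path `z` is required
to have a nonzero velocity there. -/
def IsTangentGeodesic (τ z : ℝ → ℍ) : Prop :=
  IsGeodesic τ ∧ τ 0 = z 0 ∧
    ∃ v : ℂ, v ≠ 0 ∧ HasDerivAt (fun d => (z d : ℂ)) v 0 ∧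
      ∃ k : ℝ, k ≠ 0 ∧ HasDerivAt (fun t => (τ t : ℂ)) (k * v) 0

/-- Removing `T` from `U` leaves exactly the two components `U₁` and `U₂`. -/
structure SeparatesInto {X : Type*} [TopologicalSpace X] (T U U₁ U₂ : Set X) : Prop where
  isOpen_left : IsOpen U₁
  isOpen_right : IsOpen U₂
  isConnected_left : IsConnected U₁
  isConnected_right : IsConnected U₂
  disjoint : Disjoint U₁ U₂
  union_eq : U₁ ∪ U₂ = U \ T

namespace HyperbolicSurface

/-- The points of the surface. -/
def Point (F : HyperbolicSurface) : Type := MulAction.orbitRel.Quotient F.Γ ℍ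

/-- The quotient topology. -/
instance (F : HyperbolicSurface) : TopologicalSpace F.Point :=
  inferInstanceAs (TopologicalSpace (Quotient (MulAction.orbitRel F.Γ ℍ)))

/-- The universal covering map. -/
noncomputable def proj (F : HyperbolicSurface) (z : ℍ) : F.Point :=
  Quotient.mk (MulAction.orbitRel F.Γ ℍ) z

/-- The surface is of finite type: its fundamental group is finitely generated. -/
def IsFiniteType (F : HyperbolicSurface) : Prop := F.Γ.FG

/-- The ideal point `ξ` represents a cusp of the surface: it is fixed by a parabolic deck
transformation. -/
def RepresentsCusp (F : HyperbolicSurface) (ξ : OnePoint ℝ) : Prop :=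
  IsCusp ξ (F.Γ.comap Matrix.ProjGenLinGroup.mk)

/-- The open metric disc of radius `r` in the surface about the point `F.proj w`. -/
def disc (F : HyperbolicSurface) (w : ℍ) (r : ℝ) : Set F.Point :=
  F.proj '' Metric.ball w r

/-- The projection to the surface of the path `c` is at its first self-intersection at time `s`,
where it meets the point that it visited at time `r`. -/
structure FirstSelfIntersection (F : HyperbolicSurface) (c : ℝ → ℍ) (r s : ℝ) : Prop where
  lt : r < s
  meets : F.proj (c r) = F.proj (c s)
  simple_before : Set.InjOn (fun t => F.proj (c t)) (Set.Iio s)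

/-- A lasso, given by one of its lifts: a geodesic emanating from an ideal point that represents a
cusp, followed up to the first self-intersection of its projection. The lasso itself is the
projection of the part `t ≤ endTime`. -/
structure Lasso (F : HyperbolicSurface) where
  /-- the lift emanates from the ideal point `frame • ∞` -/
  frame : GL (Fin 2) ℝ
  cusp : F.RepresentsCusp (frame • OnePoint.infty)
  /-- the time at which the lasso visits its honda for the first time -/
  firstVisit : ℝ
  /-- the time at which the lasso comes back to its honda and ends -/
  endTime : ℝ
  first : F.FirstSelfIntersection (geodesicFrom frame 0) firstVisit endTime

namespace Lasso

variable {F : HyperbolicSurface}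

/-- The lift of the honda at which the lift of the lasso ends. -/
noncomputable def hondaLift (σ : F.Lasso) : ℍ := geodesicFrom σ.frame 0 σ.endTime

/-- The honda of the lasso. -/
noncomputable def honda (σ : F.Lasso) : F.Point := F.proj σ.hondaLift

/-- The segment of the lasso from the cusp to the honda, up to the first visit of the honda. -/
noncomputable def segment (σ : F.Lasso) : Set F.Point :=
  (fun t => F.proj (geodesicFrom σ.frame 0 t)) '' Set.Iic σ.firstVisit

/-- `z`, restricted to `(-ε, ε)`, is the lift of the honda path: for each `d` in that interval the
geodesic emanating from the same cusp in the perturbed direction `d` runs into itself, and `z d` is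
the point of its lift at which its first self-intersection (the honda of the perturbed lasso)
takes place. -/
def IsHondaPathLift (σ : F.Lasso) (ε : ℝ) (z : ℝ → ℍ) : Prop :=
  ∀ d ∈ Set.Ioo (-ε) ε, ∃ r s : ℝ,
    F.FirstSelfIntersection (geodesicFrom σ.frame d) r s ∧ z d = geodesicFrom σ.frame d s

end Lasso

end HyperbolicSurface

/-! Put the cusp at `∞` and let `γ` be the deck transformation carrying the lifted end of the lasso
to its first visit of the honda. It does not preserve height, so it is `w ↦ a - D / (w + e)`, with
`w` conjugated when `D < 0`; the two orientation types are thus treated together.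

Everything local is decided in the coordinates `(x, |w|²)`, `x = re w`, in which geodesics are
straight lines `p|w|² + qx + m = 0`. The point over `d` that `γ` returns to the same vertical line
traces `|w|² = D(x+e)/(a-x) - 2ex - e²`. This differs from its tangent line `T` at `x = 0` by the
remainder `D · (a+e)/(a-x) · (x/a)²`, which has the sign of `D` because `|e| < |a|`
(`returnPoint_side`). The lift of the first segment that ends at the same point lies on the line
`|w|² = D(x+e)/a - 2ex - e²`. It differs from `T` by `-Dex/a²`, again of the sign of `D` on the part
that `γ` sends above the first visit (`ray_side`). Hence both curves lie on the same side of `T`.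

The global input is that the return points are the hondas of the nearby lassos
(`FirstSelfIntersection.eventually_firstSelfIntersection`) and that only one lift of the segment
comes near the lifted honda (`FirstSelfIntersection.exists_pos_forall_dist_lt`). Both are
compactness arguments. The noncompact end of the rays is controlled by
`im_smul_eq_or_im_smul_mul_le`, which rests on the bound for `|D|` in `abs_le_of_inversionMat_mem`.
-/

open Matrix Filter Set UpperHalfPlane

/-! ### Isometries of the upper half-plane: formulas, distances, differentials. -/

namespace UpperHalfPlane

/-- The zero set of the numerator is the geodesic that `g` takes to the imaginary axis, and its sign
tells the sides apart; the side computations all read off this numerator. -/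
theorem re_smul_eq_div_normSq (g : GL (Fin 2) ℝ) (z : ℍ) :
    (g • z).re = (g 0 0 * g 1 0 * (z.re ^ 2 + z.im ^ 2)
      + (g 0 0 * g 1 1 + g 0 1 * g 1 0) * z.re + g 0 1 * g 1 1) / Complex.normSq (denom g z) := by
  rw [re_smul, Complex.div_re, ← add_div]
  congr 1
  simp [num, denom]
  ring

theorem normSq_denom_eq (g : GL (Fin 2) ℝ) (z : ℍ) :
    Complex.normSq (denom g z) = (g 1 0 * z.re + g 1 1) ^ 2 + (g 1 0 * z.im) ^ 2 := by
  simp [denom, Complex.normSq]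
  ring

theorem num_div_denom_sub (g : GL (Fin 2) ℝ) (z w : ℍ) :
    num g z / denom g z - num g w / denom g w
      = g.det.val * ((z : ℂ) - w) / (denom g z * denom g w) := by
  rw [div_sub_div _ _ (denom_ne_zero g z) (denom_ne_zero g w)]
  congr 1
  simp only [num, denom, GeneralLinearGroup.val_det_apply, Matrix.det_fin_two]
  push_cast
  ring

/-- The Euclidean distance and the geometric mean of the heights are both multiplied by `|det g| /
(‖denom g z‖ ‖denom g w‖)`, and the hyperbolic distance depends only on their quotient. -/
theorem isometry_gl_smul (g : GL (Fin 2) ℝ) : Isometry (g • · : ℍ → ℍ) := by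
  refine Isometry.of_dist_eq fun z w => ?_
  have h1 : dist ((g • z : ℍ) : ℂ) (g • w : ℍ)
      = |g.det.val| * dist (z : ℂ) w / (‖denom g z‖ * ‖denom g w‖) := by
    rw [dist_eq_norm, dist_eq_norm, coe_smul, coe_smul, ← map_sub, norm_σ, num_div_denom_sub]
    simp
  have hz : 0 < ‖denom g z‖ := norm_pos_iff.2 (denom_ne_zero g z)
  have hw : 0 < ‖denom g w‖ := norm_pos_iff.2 (denom_ne_zero g w)
  have hd : 0 < |g.det.val| := abs_pos.2 g.det.ne_zero
  have h2 : √((g • z).im * (g • w).im)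
      = |g.det.val| * √(z.im * w.im) / (‖denom g z‖ * ‖denom g w‖) := by
    rw [im_smul_eq_div_normSq, im_smul_eq_div_normSq, Complex.normSq_eq_norm_sq,
      Complex.normSq_eq_norm_sq]
    rw [show |g.det.val| * z.im / ‖denom g z‖ ^ 2 * (|g.det.val| * w.im / ‖denom g w‖ ^ 2)
      = (|g.det.val| / (‖denom g z‖ * ‖denom g w‖)) ^ 2 * (z.im * w.im) by field_simp]
    rw [Real.sqrt_mul (sq_nonneg _), Real.sqrt_sq (by positivity)]
    ring
  have h3 : 0 < √(z.im * w.im) := Real.sqrt_pos.2 (mul_pos z.im_pos w.im_pos)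
  rw [dist_eq, dist_eq, h1, h2]
  congr 2
  field_simp

theorem smul_ball_gl (g : GL (Fin 2) ℝ) (z : ℍ) (r : ℝ) :
    (g • ·) '' Metric.ball z r = Metric.ball (g • z) r := by
  ext w
  simp only [Set.mem_image, Metric.mem_ball]
  constructor
  · rintro ⟨x, hx, rfl⟩
    rwa [(isometry_gl_smul g).dist_eq]
  · intro hw
    refine ⟨g⁻¹ • w, ?_, smul_inv_smul g w⟩
    rw [← (isometry_gl_smul g).dist_eq]
    simpa using hw

instance : ContinuousConstSMul PGL(2, ℝ) ℍ where
  continuous_const_smul γ := by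
    obtain ⟨g, rfl⟩ := ProjGenLinGroup.mk_surjective γ
    simpa using continuous_const_smul g

/-- The differential of an isometry of `ℍ` is an injective real linear map. -/
theorem exists_hasDerivAt_smul (g : GL (Fin 2) ℝ) (z : ℍ) :
    ∃ A : ℂ →ₗ[ℝ] ℂ, Function.Injective A ∧ ∀ (f : ℝ → ℍ) (t : ℝ) (v : ℂ), f t = z →
      HasDerivAt (fun s => (f s : ℂ)) v t → HasDerivAt (fun s => ((g • f s : ℍ) : ℂ)) (A v) t := by
  have hc : (g.det.val : ℂ) / denom g z ^ 2 ≠ 0 :=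
    div_ne_zero (by exact_mod_cast g.det.ne_zero) (pow_ne_zero _ (denom_ne_zero g z))
  -- Multiplication by the Möbius derivative `det / denom²`, followed by conjugation if the
  -- determinant is negative.
  refine ⟨((σ g).toLinearMap : ℂ →ₗ[ℝ] ℂ) ∘ₗ
    LinearMap.mulLeft ℝ ((g.det.val : ℂ) / denom g z ^ 2), ?_, ?_⟩
  · exact (σ g).injective.comp (mul_right_injective₀ hc)
  · rintro f t v rfl hf
    have hn : HasDerivAt (fun s => num g (f s)) (g 0 0 * v) t :=
      (hf.const_mul _).add_const _
    have hd : HasDerivAt (fun s => denom g (f s)) (g 1 0 * v) t :=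
      (hf.const_mul _).add_const _
    have h := hn.div hd (denom_ne_zero g (f t))
    have h2 := ((σ g : ℂ →L[ℝ] ℂ).hasFDerivAt.comp_hasDerivAt t h)
    convert! h2 using 1
    simp only [LinearMap.comp_apply, LinearMap.mulLeft_apply]
    change σ g _ = σ g _
    congr 1
    have := denom_ne_zero g (f t)
    field_simp
    simp only [num, denom, GeneralLinearGroup.val_det_apply, Matrix.det_fin_two]
    push_cast
    ring

end UpperHalfPlane

/-! ### Affine maps and inversions as normal forms. -/

/-- The matrix of `z ↦ a z + b`. -/
noncomputable def affineMat (a b : ℝ) (ha : a ≠ 0) : GL (Fin 2) ℝ :=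
  .mkOfDetNeZero !![a, b; 0, 1] (by simpa using ha)

/-- The matrix of `z ↦ a - D / (z + e)`. -/
noncomputable def inversionMat (a e D : ℝ) (hD : D ≠ 0) : GL (Fin 2) ℝ :=
  .mkOfDetNeZero !![a, a * e - D; 1, e] (by simpa [Matrix.det_fin_two] using hD)

theorem affineMat_smul_re (a b : ℝ) (ha : a ≠ 0) (z : ℍ) :
    (affineMat a b ha • z).re = a * z.re + b := by
  rw [re_smul_eq_div_normSq, normSq_denom_eq]
  simp [affineMat]

theorem affineMat_smul_im (a b : ℝ) (ha : a ≠ 0) (z : ℍ) :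
    (affineMat a b ha • z).im = |a| * z.im := by
  rw [im_smul_eq_div_normSq, normSq_denom_eq]
  simp [affineMat]

theorem inversionMat_smul_re (a e D : ℝ) (hD : D ≠ 0) (z : ℍ) :
    (inversionMat a e D hD • z).re
      = a - D * (z.re + e) / ((z.re + e) ^ 2 + z.im ^ 2) := by
  have : 0 < (z.re + e) ^ 2 + z.im ^ 2 := by have := z.im_pos; positivity
  rw [re_smul_eq_div_normSq, normSq_denom_eq]
  simp [inversionMat]
  field_simp
  ring

theorem inversionMat_smul_im (a e D : ℝ) (hD : D ≠ 0) (z : ℍ) :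
    (inversionMat a e D hD • z).im = |D| * z.im / ((z.re + e) ^ 2 + z.im ^ 2) := by
  rw [im_smul_eq_div_normSq, normSq_denom_eq]
  simp [inversionMat, Matrix.det_fin_two]

theorem affineMat_mul_inversionMat (b a e D : ℝ) (hD : D ≠ 0) :
    affineMat 1 b one_ne_zero * inversionMat a e D hD = inversionMat (a + b) e D hD := by
  ext i j
  fin_cases i <;> fin_cases j <;> (simp [affineMat, inversionMat, Matrix.mul_apply]; try ring)

theorem inversionMat_mul_affineMat (b a e D : ℝ) (hD : D ≠ 0) :
    inversionMat a e D hD * affineMat 1 b one_ne_zero = inversionMat a (e + b) D hD := by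
  ext i j
  fin_cases i <;> fin_cases j <;> simp [affineMat, inversionMat, Matrix.mul_apply] <;> ring

theorem affineMat_mul (a b a' b' : ℝ) (ha : a ≠ 0) (ha' : a' ≠ 0) :
    affineMat a b ha * affineMat a' b' ha' = affineMat (a * a') (a * b' + b) (mul_ne_zero ha ha') := by
  ext i j
  fin_cases i <;> fin_cases j <;> simp [affineMat, Matrix.mul_apply]

theorem affineMat_zpow (b : ℝ) (n : ℤ) :
    affineMat 1 b one_ne_zero ^ n = affineMat 1 (n * b) one_ne_zero := by
  have key (x : ℝ) : affineMat 1 x one_ne_zero = GeneralLinearGroup.upperRightHom x := by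
    ext i j
    fin_cases i <;> fin_cases j <;> simp [affineMat]
  rw [key, key, ← zsmul_eq_mul, AddChar.map_zsmul_eq_zpow]

theorem mk_inversionMat_ne_one (a e D : ℝ) (hD : D ≠ 0) :
    ProjGenLinGroup.mk (inversionMat a e D hD) ≠ 1 := by
  rw [← ProjGenLinGroup.mk_one, Ne, ProjGenLinGroup.mk_eq_mk_iff]
  rintro ⟨u, hu⟩
  have := congrArg (fun A : GL (Fin 2) ℝ => A 1 0) hu
  simp [inversionMat, Matrix.mul_apply] at this

theorem mk_eq_affineMat (g : GL (Fin 2) ℝ) (h : g 1 0 = 0) :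
    ∃ ha, ProjGenLinGroup.mk g = ProjGenLinGroup.mk (affineMat (g 0 0 / g 1 1) (g 0 1 / g 1 1) ha) := by
  have hdet := g.det.ne_zero
  rw [GeneralLinearGroup.val_det_apply, Matrix.det_fin_two, h, mul_zero, sub_zero] at hdet
  have h0 := left_ne_zero_of_mul hdet
  have h1 := right_ne_zero_of_mul hdet
  refine ⟨div_ne_zero h0 h1, ?_⟩
  symm
  rw [ProjGenLinGroup.mk_eq_mk_iff]
  refine ⟨Units.mk0 _ h1, ?_⟩
  ext i j
  fin_cases i <;> fin_cases j <;> simp [affineMat, Matrix.mul_apply, h, h1]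

theorem exists_mk_eq_inversionMat (g : GL (Fin 2) ℝ) (h : g 1 0 ≠ 0) :
    ∃ a e D hD, ProjGenLinGroup.mk g = ProjGenLinGroup.mk (inversionMat a e D hD) := by
  have hdet := g.det.ne_zero
  rw [GeneralLinearGroup.val_det_apply, Matrix.det_fin_two] at hdet
  refine ⟨g 0 0 / g 1 0, g 1 1 / g 1 0, (g 0 0 * g 1 1 - g 0 1 * g 1 0) / g 1 0 ^ 2,
    div_ne_zero hdet (pow_ne_zero _ h), ?_⟩
  symm
  rw [ProjGenLinGroup.mk_eq_mk_iff]
  refine ⟨Units.mk0 _ h, ?_⟩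
  ext i j
  fin_cases i <;> fin_cases j <;> simp [inversionMat, Matrix.mul_apply, h]
  field_simp
  ring

/-- Every isometry of `ℍ` is affine or a translate of an inversion followed by a translation. -/
theorem exists_normal_form (γ : PGL(2, ℝ)) :
    (∃ a b ha, γ = ProjGenLinGroup.mk (affineMat a b ha)) ∨
      ∃ a e D hD, γ = ProjGenLinGroup.mk (inversionMat a e D hD) := by
  obtain ⟨g, rfl⟩ := ProjGenLinGroup.mk_surjective γ
  by_cases h : g 1 0 = 0
  · obtain ⟨ha, h'⟩ := mk_eq_affineMat g h
    exact .inl ⟨_, _, ha, h'⟩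
  · exact .inr (exists_mk_eq_inversionMat g h)

@[simp]
theorem verticalGeodesic_re (x t : ℝ) : (verticalGeodesic x t).re = x := rfl

@[simp]
theorem verticalGeodesic_im (x t : ℝ) : (verticalGeodesic x t).im = Real.exp (-t) := rfl

theorem continuous_verticalGeodesic : Continuous fun p : ℝ × ℝ => verticalGeodesic p.1 p.2 := by
  refine Continuous.upperHalfPlaneMk ?_ _
  simp only [Complex.mk_eq_add_mul_I]
  fun_prop

theorem verticalGeodesic_injective (x : ℝ) : Function.Injective (verticalGeodesic x) := by
  intro s t h
  have := congrArg UpperHalfPlane.im h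
  simpa using this

theorem eq_verticalGeodesic (z : ℍ) : z = verticalGeodesic z.re (-Real.log z.im) := by
  apply UpperHalfPlane.ext_re_im
  · simp
  · simp [Real.exp_log z.im_pos]

/-! ### Deck groups, change of the universal covering, normalisation of the cusp. -/

namespace HyperbolicSurface

variable (F : HyperbolicSurface)

theorem proj_eq_iff {z w : ℍ} : F.proj z = F.proj w ↔ ∃ γ ∈ F.Γ, γ • w = z := by
  refine (Quotient.eq (r := MulAction.orbitRel F.Γ ℍ)).trans ?_
  rw [MulAction.orbitRel_apply, MulAction.mem_orbit_iff]
  exact ⟨fun ⟨γ, h⟩ => ⟨γ, γ.2, h⟩, fun ⟨γ, hγ, h⟩ => ⟨⟨γ, hγ⟩, h⟩⟩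

theorem continuous_proj : Continuous F.proj := continuous_quotient_mk'

theorem isOpenMap_proj : IsOpenMap F.proj := by
  have : ContinuousConstSMul F.Γ ℍ := ⟨fun γ => continuous_const_smul (γ : PGL(2, ℝ))⟩
  exact isOpenMap_quotient_mk'_mul

theorem finite_setOf_smul_mem {K L : Set ℍ} (hK : IsCompact K) (hL : IsCompact L) :
    {γ | γ ∈ F.Γ ∧ ∃ z ∈ K, γ • z ∈ L}.Finite := by
  have h := F.properlyDiscontinuous.finite_disjoint_inter_image hK hL
  refine (h.image Subtype.val).subset ?_
  rintro γ ⟨hγ, z, hz, hz'⟩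
  exact ⟨⟨γ, hγ⟩, ⟨_, ⟨z, hz, rfl⟩, hz'⟩, rfl⟩

theorem eq_of_smul_eq {γ γ' : PGL(2, ℝ)} (hγ : γ ∈ F.Γ) (hγ' : γ' ∈ F.Γ) {z : ℍ}
    (h : γ • z = γ' • z) : γ = γ' := by
  have := F.free (γ'⁻¹ * γ) (F.Γ.mul_mem (F.Γ.inv_mem hγ') hγ) z (by
    rw [mul_smul, h, inv_smul_smul])
  rw [inv_mul_eq_one] at this
  exact this.symm

/-- Translates of a compact set that come close to a point contain it. -/
theorem exists_pos_forall_dist_lt {K : Set ℍ} (hK : IsCompact K) (w : ℍ) :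
    ∃ ρ > 0, ∀ γ ∈ F.Γ, ∀ z ∈ K, dist (γ • z) w < ρ → ∃ z' ∈ K, γ • z' = w := by
  have hfin := F.finite_setOf_smul_mem hK (isCompact_closedBall w 1)
  set S := {γ | γ ∈ F.Γ ∧ ∃ z ∈ K, γ • z ∈ Metric.closedBall w 1}
  -- Only finitely many translates of `K` meet the unit ball about `w`, so those among them that
  -- miss `w` stay a positive distance away.
  have hclosed : IsClosed (⋃ γ ∈ {γ ∈ S | w ∉ (γ • ·) '' K}, (γ • · : ℍ → ℍ) '' K) :=
    (hfin.subset (sep_subset _ _)).isClosed_biUnion fun γ _ =>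
      (hK.image (continuous_const_smul γ)).isClosed
  have hw : w ∉ ⋃ γ ∈ {γ ∈ S | w ∉ (γ • ·) '' K}, (γ • · : ℍ → ℍ) '' K := by
    simp only [mem_iUnion, not_exists]
    exact fun γ hγ h => hγ.2 h
  obtain ⟨ρ, hρ, hball⟩ := Metric.isOpen_iff.1 hclosed.isOpen_compl w hw
  refine ⟨min ρ 1, lt_min hρ one_pos, fun γ hγ z hz hd => ?_⟩
  by_contra hne
  refine hball (Metric.mem_ball.2 (hd.trans_le (min_le_left _ _))) ?_
  simp only [mem_iUnion]
  exact ⟨γ, ⟨⟨hγ, z, hz, (hd.trans_le (min_le_right _ _)).le⟩, fun ⟨z', h, h'⟩ => hne ⟨z', h, h'⟩⟩,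
    z, hz, rfl⟩

/-- The covering map is injective on small discs. -/
theorem exists_pos_forall_eq_one (w : ℍ) :
    ∃ η > 0, ∀ γ ∈ F.Γ, ∀ z ∈ Metric.ball w η, γ • z ∈ Metric.ball w η → γ = 1 := by
  have : ContinuousConstSMul F.Γ ℍ := ⟨fun γ => continuous_const_smul (γ : PGL(2, ℝ))⟩
  have := F.properlyDiscontinuous
  obtain ⟨U, hU, h⟩ := ProperlyDiscontinuousSMul.exists_nhds_image_smul_eq_self F.Γ w
  obtain ⟨η, hη, hball⟩ := Metric.mem_nhds_iff.1 hU
  refine ⟨η, hη, fun γ hγ z hz hz' => F.free γ hγ w ?_⟩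
  exact h ⟨γ, hγ⟩ ⟨_, ⟨z, hball hz, rfl⟩, hball hz'⟩

/-- The same surface, with the universal covering changed by an isometry. -/
def conj (g : GL (Fin 2) ℝ) : HyperbolicSurface where
  Γ := F.Γ.comap (MulAut.conj (ProjGenLinGroup.mk g)).toMonoidHom
  properlyDiscontinuous := by
    constructor
    intro K L hK hL
    have h := F.finite_setOf_smul_mem (hK.image (continuous_const_smul g))
      (hL.image (continuous_const_smul g))
    refine Finite.of_finite_image (f := fun γ => MulAut.conj (ProjGenLinGroup.mk g) γ.1)
      (h.subset ?_) ?_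
    · rintro _ ⟨γ, ⟨_, ⟨z, hz, rfl⟩, hz'⟩, rfl⟩
      refine ⟨γ.2, _, ⟨z, hz, rfl⟩, _, hz', ?_⟩
      simp [MulAut.conj_apply, mul_smul, ← pglMk_smul]
      rfl
    · exact ((MulAut.conj _).injective.comp Subtype.val_injective).injOn
  free γ hγ z hz := by
    have := F.free _ hγ (g • z) (by
      simp [MulAut.conj_apply, mul_smul, ← pglMk_smul, hz])
    simpa using this

theorem mem_conj_Γ {g : GL (Fin 2) ℝ} {γ : PGL(2, ℝ)} :
    γ ∈ (F.conj g).Γ ↔ ProjGenLinGroup.mk g * γ * (ProjGenLinGroup.mk g)⁻¹ ∈ F.Γ := Iff.rfl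

theorem conj_proj_eq_iff {g : GL (Fin 2) ℝ} {z w : ℍ} :
    (F.conj g).proj z = (F.conj g).proj w ↔ F.proj (g • z) = F.proj (g • w) := by
  rw [proj_eq_iff, proj_eq_iff]
  constructor
  · rintro ⟨γ, hγ, rfl⟩
    exact ⟨_, F.mem_conj_Γ.1 hγ, by simp [mul_smul, ← pglMk_smul]⟩
  · rintro ⟨γ, hγ, h⟩
    refine ⟨(ProjGenLinGroup.mk g)⁻¹ * γ * ProjGenLinGroup.mk g, F.mem_conj_Γ.2 ?_, ?_⟩
    · simpa [mul_assoc] using hγ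
    · rw [mul_smul, mul_smul, pglMk_smul, h, ← pglMk_smul, inv_smul_smul]

theorem conj_firstSelfIntersection_iff {g : GL (Fin 2) ℝ} {d r s : ℝ} :
    (F.conj g).FirstSelfIntersection (verticalGeodesic d) r s ↔
      F.FirstSelfIntersection (geodesicFrom g d) r s := by
  constructor
  · rintro ⟨h1, h2, h3⟩
    exact ⟨h1, F.conj_proj_eq_iff.1 h2, fun t ht u hu h => h3 ht hu (F.conj_proj_eq_iff.2 h)⟩
  · rintro ⟨h1, h2, h3⟩
    exact ⟨h1, F.conj_proj_eq_iff.2 h2, fun t ht u hu h => h3 ht hu (F.conj_proj_eq_iff.1 h)⟩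

/-- A cusp at `∞` provides a translation. -/
theorem exists_translation_of_representsCusp {g : GL (Fin 2) ℝ}
    (h : F.RepresentsCusp (g • OnePoint.infty)) :
    ∃ b > 0, ProjGenLinGroup.mk (affineMat 1 b one_ne_zero) ∈ (F.conj g).Γ := by
  obtain ⟨A, hA, hpar, hfix⟩ := h
  have hfix' : (g⁻¹ * A * g) • (OnePoint.infty : OnePoint ℝ) = OnePoint.infty := by
    rw [mul_smul, mul_smul, hfix, inv_smul_smul]
  rw [OnePoint.smul_infty_eq_self_iff] at hfix'
  have hpar' : (g⁻¹ * A * g).IsParabolic := by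
    simpa using hpar
  rw [GeneralLinearGroup.isParabolic_iff_of_upperTriangular hfix'] at hpar'
  have hmem : ProjGenLinGroup.mk (g⁻¹ * A * g) ∈ (F.conj g).Γ := by
    rw [mem_conj_Γ]
    simpa [mul_assoc] using hA
  obtain ⟨ha, h'⟩ := mk_eq_affineMat _ hfix'
  generalize g⁻¹ * A * g = B at *
  have h11 : B 1 1 ≠ 0 := by
    rintro h0
    simp [h0] at ha
  have h00 : B 0 0 / B 1 1 = 1 := by rw [hpar'.1, div_self h11]
  rw [h'] at hmem
  simp only [h00] at hmem
  have hb : B 0 1 / B 1 1 ≠ 0 := div_ne_zero hpar'.2 h11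
  rcases hb.lt_or_gt with hb | hb
  · refine ⟨-(B 0 1 / B 1 1), by linarith, ?_⟩
    have := (F.conj g).Γ.inv_mem hmem
    rwa [← map_inv, ← _root_.zpow_neg_one, affineMat_zpow, Int.cast_neg, Int.cast_one, neg_one_mul]
      at this
  · exact ⟨_, hb, hmem⟩

end HyperbolicSurface

/-! ### Height control from the cusp and from simplicity of the ray. -/

namespace HyperbolicSurface

variable {F : HyperbolicSurface} {b r₀ s₀ : ℝ}

/-- An affine map with linear coefficient of modulus less than `1` generates, together with a
translation, a non-discrete group. -/
theorem one_le_abs_of_affineMat_mem (hb : 0 < b)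
    (hT : ProjGenLinGroup.mk (affineMat 1 b one_ne_zero) ∈ F.Γ) {a c : ℝ} {ha : a ≠ 0}
    (hA : ProjGenLinGroup.mk (affineMat a c ha) ∈ F.Γ) : 1 ≤ |a| := by
  by_contra! hlt
  -- Conjugating a translation by the affine map multiplies its length by `a`, which produces
  -- arbitrarily short translations.
  have hmem (n : ℕ) : ProjGenLinGroup.mk (affineMat 1 (a ^ n * b) one_ne_zero) ∈ F.Γ := by
    induction n with
    | zero => simpa using hT
    | succ n ih =>
      have h := F.Γ.mul_mem (F.Γ.mul_mem hA ih) (F.Γ.inv_mem hA)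
      rw [← map_inv, ← map_mul, ← map_mul] at h
      convert h using 2
      rw [eq_mul_inv_iff_mul_eq, affineMat_mul, affineMat_mul]
      congr 1 <;> ring
  have hK : IsCompact ((fun x => verticalGeodesic x 0) '' Icc (-b) b) :=
    isCompact_Icc.image (continuous_verticalGeodesic.comp (by fun_prop : Continuous fun x : ℝ => (x, (0 : ℝ))))
  have key (x : ℝ) : ProjGenLinGroup.mk (affineMat 1 x one_ne_zero) • verticalGeodesic 0 0
      = verticalGeodesic x 0 := by
    rw [pglMk_smul]
    apply UpperHalfPlane.ext_re_im
    · simp [affineMat_smul_re]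
    · simp [affineMat_smul_im]
  refine infinite_of_injective_forall_mem (f := fun n : ℕ =>
    ProjGenLinGroup.mk (affineMat 1 (a ^ n * b) one_ne_zero)) ?_ ?_
    (F.finite_setOf_smul_mem (isCompact_singleton (x := verticalGeodesic 0 0)) hK)
  · intro m n h
    have h' := congrArg (fun γ : PGL(2, ℝ) => (γ • verticalGeodesic 0 0).re) h
    simp only [key, verticalGeodesic_re] at h'
    have h'' := congrArg abs (mul_right_cancel₀ hb.ne' h')
    rw [abs_pow, abs_pow] at h''
    exact (pow_right_strictAnti₀ (abs_pos.2 ha) hlt).injective h''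
  · intro n
    refine ⟨hmem n, _, rfl, ?_⟩
    rw [key]
    refine mem_image_of_mem _ (abs_le.1 ?_)
    rw [abs_mul, abs_pow, abs_of_pos hb]
    exact mul_le_of_le_one_left hb.le (pow_le_one₀ (abs_nonneg _) hlt.le)

/-- The previous bound applies to the map and to its inverse; so deck transformations fixing `∞`
preserve height. -/
theorem abs_eq_one_of_affineMat_mem (hb : 0 < b)
    (hT : ProjGenLinGroup.mk (affineMat 1 b one_ne_zero) ∈ F.Γ) {a c : ℝ} {ha : a ≠ 0}
    (hA : ProjGenLinGroup.mk (affineMat a c ha) ∈ F.Γ) : |a| = 1 := by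
  refine le_antisymm ?_ (one_le_abs_of_affineMat_mem hb hT hA)
  have hinv : (affineMat a c ha)⁻¹ = affineMat a⁻¹ (-(a⁻¹ * c)) (inv_ne_zero ha) := by
    rw [inv_eq_iff_mul_eq_one, affineMat_mul]
    ext i j
    fin_cases i <;> fin_cases j <;> simp [affineMat, ha]
  have h := F.Γ.inv_mem hA
  rw [← map_inv, hinv] at h
  have h' := one_le_abs_of_affineMat_mem hb hT h
  rw [abs_inv] at h'
  exact (one_le_inv₀ (abs_pos.2 ha)).1 h'

theorem exists_int_add_mul_mem (hb : 0 < b) (x y : ℝ) : ∃ n : ℤ, x + n * b ∈ Ico y (y + b) := by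
  obtain ⟨n, hn, -⟩ := existsUnique_add_zsmul_mem_Ico hb x y
  exact ⟨n, by simpa using hn⟩

/-- If the vertical geodesic over `0` is simple above height `exp (-s₀)`, the isometric circles of
the deck transformations are bounded. -/
theorem abs_le_of_inversionMat_mem (hb : 0 < b)
    (hT : ProjGenLinGroup.mk (affineMat 1 b one_ne_zero) ∈ F.Γ)
    (hinj : InjOn (fun t => F.proj (verticalGeodesic 0 t)) (Iio s₀)) {a e D : ℝ} {hD : D ≠ 0}
    (hA : ProjGenLinGroup.mk (inversionMat a e D hD) ∈ F.Γ) :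
    |D| ≤ 16 * b ^ 2 + 16 * Real.exp (-s₀) ^ 2 := by
  by_contra! hlt
  obtain ⟨k, hk⟩ := exists_int_add_mul_mem hb a b
  obtain ⟨l, u, hu, hDu⟩ : ∃ l : ℤ, ∃ u ∈ Icc (3 * b) (4 * b),
      D * (e + l * b) = |D| * u ∧ (e + l * b) ^ 2 = u ^ 2 := by
    rcases hD.lt_or_gt with h | h
    · obtain ⟨l, hl⟩ := exists_int_add_mul_mem hb e (-4 * b)
      refine ⟨l, -(e + l * b), ⟨by linarith [hl.2], by linarith [hl.1]⟩, ?_, by ring⟩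
      rw [abs_of_neg h]; ring
    · obtain ⟨l, hl⟩ := exists_int_add_mul_mem hb e (3 * b)
      refine ⟨l, e + l * b, ⟨by linarith [hl.1], by linarith [hl.2]⟩, ?_, by ring⟩
      rw [abs_of_pos h]
  have hmem : ProjGenLinGroup.mk (inversionMat (a + k * b) (e + l * b) D hD) ∈ F.Γ := by
    have h := F.Γ.mul_mem (F.Γ.mul_mem (F.Γ.zpow_mem hT k) hA) (F.Γ.zpow_mem hT l)
    rwa [← map_zpow, ← map_zpow, affineMat_zpow, affineMat_zpow, ← map_mul, ← map_mul,
      affineMat_mul_inversionMat, inversionMat_mul_affineMat] at h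
  generalize a + k * b = a' at *
  generalize e + l * b = e' at *
  have ha' : 0 < a' := hb.trans_le hk.1
  have hu0 : 0 < u := by linarith [hu.1]
  have hD0 : 0 < |D| := abs_pos.2 hD
  have hE := Real.exp_pos (-s₀)
  have hN : 3 / 2 * |D| ≤ |D| * u / a' := by
    rw [le_div_iff₀ ha']
    nlinarith [hk.2, hu.1]
  have hy2 : 16 * Real.exp (-s₀) ^ 2 < |D| * u / a' - u ^ 2 := by
    nlinarith [hu.1, hu.2]
  -- The height at which the axis is returned to itself, at the new height `a' / u * y`. The ratio
  -- is below `1`, so the two points differ, and at least `1/4`, so both are above `exp (-s₀)`: this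
  -- contradicts simplicity.
  set y := √(|D| * u / a' - u ^ 2)
  have hy : y ^ 2 = |D| * u / a' - u ^ 2 := Real.sq_sqrt (by nlinarith)
  have hy0 : 0 < y := Real.sqrt_pos.2 (by nlinarith)
  have hy4 : 4 * Real.exp (-s₀) < y := by
    refine lt_of_pow_lt_pow_left₀ 2 hy0.le ?_
    rw [hy]; linarith
  set t := -Real.log y
  have ht : Real.exp (-t) = y := by simp [t, Real.exp_log hy0]
  set z := inversionMat a' e' D hD • verticalGeodesic 0 t with hz
  have hNz : (0 + e') ^ 2 + y ^ 2 = |D| * u / a' := by rw [zero_add, hDu.2, hy]; ring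
  have hre : z.re = 0 := by
    rw [hz, inversionMat_smul_re, verticalGeodesic_re, verticalGeodesic_im, ht, hNz, zero_add, hDu.1]
    field_simp
    simp
  have him : z.im = a' / u * y := by
    rw [hz, inversionMat_smul_im, verticalGeodesic_re, verticalGeodesic_im, ht, hNz]
    field_simp
  have hlt1 : a' / u < 1 := by
    rw [div_lt_one hu0]; linarith [hk.2, hu.1]
  have hlt2 : 1 / 4 ≤ a' / u := by
    rw [div_le_div_iff₀ (by norm_num) hu0]; linarith [hk.1, hu.2]
  have hzv : z = verticalGeodesic 0 (-Real.log z.im) := by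
    rw [← hre]; exact eq_verticalGeodesic z
  have h1 : t < s₀ := by
    rw [← neg_lt_neg_iff, ← Real.exp_lt_exp, ht]; linarith
  have h2 : -Real.log z.im < s₀ := by
    rw [← neg_lt_neg_iff, ← Real.exp_lt_exp, neg_neg, Real.exp_log z.im_pos, him]
    nlinarith
  have h3 := hinj (x₁ := -Real.log z.im) (x₂ := t) h2 h1 (by
    change F.proj _ = F.proj _
    rw [← hzv]
    exact F.proj_eq_iff.2 ⟨_, hmem, by rw [pglMk_smul]⟩)
  have h4 : z.im = y := by
    rw [← ht, ← h3, neg_neg, Real.exp_log z.im_pos]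
  rw [him] at h4
  nlinarith

/-- Deck transformations do not map high points to high points, unless they preserve the height. -/
theorem im_smul_eq_or_im_smul_mul_le (hb : 0 < b)
    (hT : ProjGenLinGroup.mk (affineMat 1 b one_ne_zero) ∈ F.Γ)
    (hinj : InjOn (fun t => F.proj (verticalGeodesic 0 t)) (Iio s₀)) {γ : PGL(2, ℝ)}
    (hγ : γ ∈ F.Γ) (z : ℍ) :
    (γ • z).im = z.im ∨ (γ • z).im * z.im ≤ 16 * b ^ 2 + 16 * Real.exp (-s₀) ^ 2 := by
  obtain ⟨a, c, ha, rfl⟩ | ⟨a, e, D, hD, rfl⟩ := exists_normal_form γ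
  · left
    rw [pglMk_smul, affineMat_smul_im, abs_eq_one_of_affineMat_mem hb hT hγ, one_mul]
  · right
    -- The product of the two heights is `|D| y² / ((x + e)² + y²)`, at most `|D|`.
    refine le_trans ?_ (abs_le_of_inversionMat_mem hb hT hinj hγ)
    rw [pglMk_smul, inversionMat_smul_im, div_mul_eq_mul_div, div_le_iff₀ (by have := z.im_pos; positivity)]
    nlinarith [abs_nonneg D, sq_nonneg (z.re + e), mul_nonneg (abs_nonneg D) (sq_nonneg (z.re + e))]

theorem neg_log_le_of_exp_neg_le {x C : ℝ} (h : Real.exp (-x) ≤ C) : -Real.log C ≤ x := by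
  rw [neg_le, Real.le_log_iff_exp_le ((Real.exp_pos _).trans_le h)]
  exact h

/-- The deck transformation that takes the end of a lasso to its first visit of the honda. -/
theorem FirstSelfIntersection.exists_inversionMat (hb : 0 < b)
    (hT : ProjGenLinGroup.mk (affineMat 1 b one_ne_zero) ∈ F.Γ)
    (h : F.FirstSelfIntersection (verticalGeodesic 0) r₀ s₀) :
    ∃ a e D hD, ProjGenLinGroup.mk (inversionMat a e D hD) ∈ F.Γ ∧
      inversionMat a e D hD • verticalGeodesic 0 s₀ = verticalGeodesic 0 r₀ ∧ a ≠ 0 ∧ e ≠ 0 ∧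
      D * e / a = e ^ 2 + Real.exp (-s₀) ^ 2 ∧ e ^ 2 + Real.exp (-s₀) ^ 2 < |D| := by
  obtain ⟨γ, hγ, hmeet⟩ := F.proj_eq_iff.1 h.meets
  have hlt : Real.exp (-s₀) < Real.exp (-r₀) := Real.exp_lt_exp.2 (neg_lt_neg h.lt)
  have hE := Real.exp_pos (-s₀)
  obtain ⟨a, c, ha, rfl⟩ | ⟨a, e, D, hD, rfl⟩ := exists_normal_form γ
  · have := congrArg UpperHalfPlane.im hmeet
    rw [pglMk_smul, affineMat_smul_im, abs_eq_one_of_affineMat_mem hb hT hγ, one_mul] at this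
    exact absurd this hlt.ne
  rw [pglMk_smul] at hmeet
  have hre := congrArg UpperHalfPlane.re hmeet
  have him := congrArg UpperHalfPlane.im hmeet
  rw [inversionMat_smul_re] at hre
  rw [inversionMat_smul_im] at him
  simp only [verticalGeodesic_re, verticalGeodesic_im, zero_add] at hre him
  have hN : 0 < e ^ 2 + Real.exp (-s₀) ^ 2 := by positivity
  -- With `e = 0` also `a = 0`, and then `γ` fixes the point of height `√|D|` on the axis, against
  -- freeness.
  have he : e ≠ 0 := by
    rintro rfl
    have ha : a = 0 := by simpa using hre
    subst ha
    refine mk_inversionMat_ne_one 0 0 D hD (F.free _ hγ (verticalGeodesic 0 (-Real.log √|D|)) ?_)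
    have hD0 : 0 < |D| := abs_pos.2 hD
    have hs : 0 < √|D| := Real.sqrt_pos.2 hD0
    rw [pglMk_smul]
    apply UpperHalfPlane.ext_re_im
    · simp [inversionMat_smul_re]
    · simp [inversionMat_smul_im, Real.exp_log hs, Real.sq_sqrt hD0.le]
      field_simp
  have haN : a * (e ^ 2 + Real.exp (-s₀) ^ 2) = D * e := by
    field_simp at hre
    linarith
  have ha : a ≠ 0 := by
    rintro rfl
    rw [zero_mul] at haN
    exact mul_ne_zero hD he haN.symm
  refine ⟨a, e, D, hD, hγ, hmeet, ha, he, ?_, ?_⟩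
  · rw [← haN]; field_simp
  · rw [← him, lt_div_iff₀ hN, mul_comm] at hlt
    exact lt_of_mul_lt_mul_right hlt hE.le

/-- Only one deck transformation brings the part of a lasso before the first visit of the honda
close to the lift of the honda at the end of the lasso. -/
theorem FirstSelfIntersection.exists_pos_forall_dist_lt (hb : 0 < b)
    (hT : ProjGenLinGroup.mk (affineMat 1 b one_ne_zero) ∈ F.Γ)
    (h : F.FirstSelfIntersection (verticalGeodesic 0) r₀ s₀) {γ : PGL(2, ℝ)} (hγ : γ ∈ F.Γ)
    (hmeet : γ • verticalGeodesic 0 s₀ = verticalGeodesic 0 r₀) :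
    ∃ ρ > 0, ∀ γ' ∈ F.Γ, ∀ t ≤ r₀,
      dist (γ' • verticalGeodesic 0 t) (verticalGeodesic 0 s₀) < ρ → γ' = γ⁻¹ := by
  set C := 16 * b ^ 2 + 16 * Real.exp (-s₀) ^ 2
  -- A time before which no translate of the ray comes within distance `1` of the lifted honda; the
  -- two terms of the maximum belong to the two alternatives of `im_smul_eq_or_im_smul_mul_le`. Only
  -- a compact piece of the ray remains.
  set M := -Real.log (max (Real.exp (-s₀ + 1)) (C * Real.exp (s₀ + 1)))
  have hK : IsCompact (verticalGeodesic 0 '' Icc M r₀) :=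
    isCompact_Icc.image (continuous_verticalGeodesic.comp (by fun_prop : Continuous fun x : ℝ => ((0 : ℝ), x)))
  obtain ⟨ρ, hρ, hρK⟩ := F.exists_pos_forall_dist_lt hK (verticalGeodesic 0 s₀)
  refine ⟨min ρ 1, lt_min hρ one_pos, fun γ' hγ' t ht hd => ?_⟩
  have hM : M ≤ t := by
    refine neg_log_le_of_exp_neg_le (le_max_iff.2 ?_)
    have hd1 := hd.le.trans (min_le_right _ _)
    rcases im_smul_eq_or_im_smul_mul_le hb hT h.simple_before hγ' (verticalGeodesic 0 t) with h1 | h1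
    · left
      rw [verticalGeodesic_im] at h1
      rw [← h1]
      refine (im_le_im_mul_exp_dist _ (verticalGeodesic 0 s₀)).trans ?_
      rw [verticalGeodesic_im, Real.exp_add]
      gcongr
    · right
      have h2 := im_div_exp_dist_le (verticalGeodesic 0 s₀) (γ' • verticalGeodesic 0 t)
      rw [verticalGeodesic_im, dist_comm, ← Real.exp_sub] at h2
      have h3 : Real.exp (-(s₀ + 1)) ≤ (γ' • verticalGeodesic 0 t).im :=
        (Real.exp_le_exp.2 (by linarith)).trans h2
      rw [verticalGeodesic_im] at h1
      have h4 : Real.exp (-(s₀ + 1)) * Real.exp (-t) ≤ C :=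
        (mul_le_mul_of_nonneg_right h3 (Real.exp_pos _).le).trans h1
      rwa [Real.exp_neg (s₀ + 1), inv_mul_le_iff₀ (Real.exp_pos _), mul_comm] at h4
  obtain ⟨_, ⟨t', ht', rfl⟩, hw⟩ := hρK γ' hγ' _ ⟨t, ⟨hM, ht⟩, rfl⟩ (hd.trans_le (min_le_left _ _))
  have : t' = r₀ := h.simple_before (ht'.2.trans_lt h.lt) h.lt
    ((F.proj_eq_iff.2 ⟨γ', hγ', hw⟩).symm.trans h.meets.symm)
  subst this
  refine F.eq_of_smul_eq hγ' (F.Γ.inv_mem hγ) (z := verticalGeodesic 0 t') ?_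
  rw [hw, ← hmeet, inv_smul_smul]

end HyperbolicSurface

/-! ### The curve of return points and the stability of lassos. -/

/-- The square of the height at which the vertical geodesic over `d` is mapped to itself by the
isometry with matrix `inversionMat a e D`. -/
noncomputable def returnHeightSq (a e D d : ℝ) : ℝ := D * (d + e) / (a - d) - (d + e) ^ 2

/-- The point at which the vertical geodesic over `d` is mapped to itself by the
isometry with matrix `inversionMat a e D`. -/
noncomputable def returnPoint (a e D d : ℝ) : ℍ :=
  verticalGeodesic d (-Real.log √(returnHeightSq a e D d))

theorem returnPoint_im {a e D d : ℝ} (h : 0 < returnHeightSq a e D d) :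
    (returnPoint a e D d).im = √(returnHeightSq a e D d) := by
  rw [returnPoint, verticalGeodesic_im, neg_neg, Real.exp_log (Real.sqrt_pos.2 h)]

theorem differentiableAt_returnHeightSq {a e D d : ℝ} (h : a - d ≠ 0) :
    DifferentiableAt ℝ (returnHeightSq a e D) d := by
  unfold returnHeightSq
  fun_prop (disch := assumption)

theorem inversionMat_smul_re_eq_self_iff {a e D : ℝ} {hD : D ≠ 0} {z : ℍ} (h : a - z.re ≠ 0) :
    (inversionMat a e D hD • z).re = z.re ↔ z.im ^ 2 = returnHeightSq a e D z.re := by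
  have : 0 < (z.re + e) ^ 2 + z.im ^ 2 := by have := z.im_pos; positivity
  rw [inversionMat_smul_re, returnHeightSq, sub_eq_iff_eq_add, ← sub_eq_iff_eq_add', eq_div_iff this.ne',
    eq_sub_iff_add_eq, eq_div_iff h]
  constructor <;> intro h' <;> linarith

namespace HyperbolicSurface

variable {F : HyperbolicSurface} {b r₀ s₀ : ℝ}

/-- Vertical geodesics close to a lasso have no self-intersection before the expected one. -/
theorem FirstSelfIntersection.eventually_injOn (hb : 0 < b)
    (hT : ProjGenLinGroup.mk (affineMat 1 b one_ne_zero) ∈ F.Γ)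
    (h : F.FirstSelfIntersection (verticalGeodesic 0) r₀ s₀) {γ : PGL(2, ℝ)} (hγ : γ ∈ F.Γ)
    (hmeet : γ • verticalGeodesic 0 s₀ = verticalGeodesic 0 r₀) {S : ℝ → ℝ}
    (hS : ContinuousAt S 0) (hS0 : S 0 = s₀)
    (huniq : ∀ᶠ d in 𝓝 0, ∀ t, (γ • verticalGeodesic d t).re = d → t = S d) :
    ∀ᶠ d in 𝓝 0, InjOn (fun t => F.proj (verticalGeodesic d t)) (Iio (S d)) := by
  set C := 16 * b ^ 2 + 16 * Real.exp (-s₀) ^ 2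
  set M := -Real.log (C * Real.exp (s₀ + 1))
  have hK : IsCompact ((fun p : ℝ × ℝ => verticalGeodesic p.1 p.2) ''
      (Icc (-1) 1 ×ˢ Icc M (s₀ + 1))) :=
    (isCompact_Icc.prod isCompact_Icc).image continuous_verticalGeodesic
  have hfin := F.finite_setOf_smul_mem hK hK
  have hQ : IsCompact (Icc M (s₀ + 1) ×ˢ Icc M (s₀ + 1)) := isCompact_Icc.prod isCompact_Icc
  -- The inequalities are weak so that the excluded condition is closed and survives a limit `d →
  -- 0`. The limiting cases are ruled out at `d = 0`: equal times would give a fixed point, and `p.2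
  -- = s₀` would force `γ' = γ`.
  have hlimit : ∀ γ' ∈ F.Γ, γ' ≠ 1 → γ' ≠ γ → ∀ᶠ d in 𝓝 (0 : ℝ),
      ∀ p ∈ Icc M (s₀ + 1) ×ˢ Icc M (s₀ + 1),
        ¬(p.1 ≤ p.2 ∧ p.2 ≤ S d ∧ γ' • verticalGeodesic d p.2 = verticalGeodesic d p.1) := by
    intro γ' hγ' h1 hne
    refine hQ.eventually_forall_of_forall_eventually fun p hp => ?_
    have hc1 : ContinuousAt (fun q : ℝ × ℝ × ℝ => q.2.1) (0, p) := by fun_prop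
    have hc2 : ContinuousAt (fun q : ℝ × ℝ × ℝ => q.2.2) (0, p) := by fun_prop
    have hc3 : ContinuousAt (fun q : ℝ × ℝ × ℝ => S q.1) (0, p) :=
      ContinuousAt.comp (g := S) (f := Prod.fst) hS continuousAt_fst
    by_cases hp1 : p.2 < p.1
    · filter_upwards [hc2.eventually_lt hc1 hp1] with q hq hq'
      exact hq.not_ge hq'.1
    by_cases hp2 : S 0 < p.2
    · filter_upwards [hc3.eventually_lt hc2 hp2] with q hq hq'
      exact hq.not_ge hq'.2.1
    have hp3 : γ' • verticalGeodesic 0 p.2 ≠ verticalGeodesic 0 p.1 := by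
      intro heq
      rw [not_lt] at hp1 hp2
      rw [hS0] at hp2
      have hproj := F.proj_eq_iff.2 ⟨γ', hγ', heq⟩
      rcases hp1.eq_or_lt with h12 | h12
      · rw [h12] at heq
        exact h1 (F.free γ' hγ' _ heq)
      rcases hp2.eq_or_lt with h2 | h2
      · rw [h2] at h12 hproj heq
        have : p.1 = r₀ := h.simple_before h12 h.lt (hproj.trans h.meets.symm)
        rw [this, ← hmeet] at heq
        exact hne (F.eq_of_smul_eq hγ' hγ heq)
      · exact h12.ne (h.simple_before (h12.trans h2) h2 hproj)
    have hc4 : Continuous (fun q : ℝ × ℝ × ℝ => γ' • verticalGeodesic q.1 q.2.2) :=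
      (continuous_verticalGeodesic.comp (by fun_prop : Continuous fun q : ℝ × ℝ × ℝ =>
        (q.1, q.2.2))).const_smul γ'
    have hc5 : Continuous (fun q : ℝ × ℝ × ℝ => verticalGeodesic q.1 q.2.1) :=
      continuous_verticalGeodesic.comp (by fun_prop : Continuous fun q : ℝ × ℝ × ℝ =>
        (q.1, q.2.1))
    filter_upwards [(isClosed_eq hc4 hc5).isOpen_compl.mem_nhds hp3] with q hq hq'
    exact hq hq'.2.2
  have hall : ∀ᶠ d in 𝓝 (0 : ℝ), ∀ γ' ∈ {γ' | γ' ∈ F.Γ ∧ ∃ z ∈ ((fun p : ℝ × ℝ =>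
      verticalGeodesic p.1 p.2) '' (Icc (-1) 1 ×ˢ Icc M (s₀ + 1))), γ' • z ∈ ((fun p : ℝ × ℝ =>
      verticalGeodesic p.1 p.2) '' (Icc (-1) 1 ×ˢ Icc M (s₀ + 1)))}, γ' ≠ 1 → γ' ≠ γ →
      ∀ p ∈ Icc M (s₀ + 1) ×ˢ Icc M (s₀ + 1),
        ¬(p.1 ≤ p.2 ∧ p.2 ≤ S d ∧ γ' • verticalGeodesic d p.2 = verticalGeodesic d p.1) := by
    rw [eventually_all_finite hfin]
    intro γ' hγ'
    by_cases h1 : γ' = 1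
    · exact .of_forall fun d hd => absurd h1 hd
    by_cases h2 : γ' = γ
    · exact .of_forall fun d _ hd => absurd h2 hd
    filter_upwards [hlimit γ' hγ'.1 h1 h2] with d hd _ _ using hd
  have hS1 : ∀ᶠ d in 𝓝 (0 : ℝ), S d < s₀ + 1 :=
    hS.eventually_lt_const (by rw [hS0]; linarith)
  filter_upwards [hall, hS1, huniq, Icc_mem_nhds (by norm_num : (-1 : ℝ) < 0) one_pos]
    with d hd hSd hu hd1
  have key : ∀ t₁ t₂, t₁ < t₂ → t₂ < S d →
      F.proj (verticalGeodesic d t₁) ≠ F.proj (verticalGeodesic d t₂) := by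
    intro t₁ t₂ h12 h2 heq
    obtain ⟨γ', hγ', heq⟩ := F.proj_eq_iff.1 heq
    have him := im_smul_eq_or_im_smul_mul_le hb hT h.simple_before hγ' (verticalGeodesic d t₂)
    rw [heq, verticalGeodesic_im, verticalGeodesic_im] at him
    rcases him with him | him
    · rw [Real.exp_eq_exp, neg_inj] at him
      exact h12.ne him
    -- The heights differ, so their product is at most `C`; as `t₂ < s₀ + 1`, the earlier point
    -- cannot be too high either.
    have hM : M ≤ t₁ := by
      refine neg_log_le_of_exp_neg_le ?_
      have h4 : Real.exp (-(s₀ + 1)) * Real.exp (-t₁) ≤ C := by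
        refine le_trans ?_ him
        rw [mul_comm]
        gcongr
        linarith
      rwa [Real.exp_neg (s₀ + 1), inv_mul_le_iff₀ (Real.exp_pos _), mul_comm] at h4
    have ht1 : t₁ ∈ Icc M (s₀ + 1) := ⟨hM, by linarith⟩
    have ht2 : t₂ ∈ Icc M (s₀ + 1) := ⟨by linarith, by linarith⟩
    refine hd γ' ⟨hγ', _, ⟨(d, t₂), ⟨hd1, ht2⟩, rfl⟩, (d, t₁), ⟨hd1, ht1⟩, heq.symm⟩ ?_ ?_
      (t₁, t₂) ⟨ht1, ht2⟩ ⟨h12.le, h2.le, heq⟩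
    · rintro rfl
      rw [one_smul] at heq
      exact h12.ne' (verticalGeodesic_injective d heq)
    · rintro rfl
      exact h2.ne (hu t₂ (by rw [heq, verticalGeodesic_re]))
  intro t₁ ht₁ t₂ ht₂ heq
  rcases lt_trichotomy t₁ t₂ with hlt | hlt | hlt
  · exact absurd heq (key _ _ hlt ht₂)
  · exact hlt
  · exact absurd heq.symm (key _ _ hlt ht₁)

/-- Vertical geodesics close to a lasso are lassos. -/
theorem FirstSelfIntersection.eventually_firstSelfIntersection (hb : 0 < b)
    (hT : ProjGenLinGroup.mk (affineMat 1 b one_ne_zero) ∈ F.Γ)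
    (h : F.FirstSelfIntersection (verticalGeodesic 0) r₀ s₀) {a e D : ℝ} {hD : D ≠ 0}
    (hγ : ProjGenLinGroup.mk (inversionMat a e D hD) ∈ F.Γ)
    (hmeet : inversionMat a e D hD • verticalGeodesic 0 s₀ = verticalGeodesic 0 r₀) (ha : a ≠ 0)
    (hN : D * e / a = e ^ 2 + Real.exp (-s₀) ^ 2) (hlt : e ^ 2 + Real.exp (-s₀) ^ 2 < |D|) :
    ∀ᶠ d in 𝓝 0, ∃ r, F.FirstSelfIntersection (verticalGeodesic d) r
      (-Real.log √(returnHeightSq a e D d)) := by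
  have hH0 : returnHeightSq a e D 0 = Real.exp (-s₀) ^ 2 := by
    simp only [returnHeightSq, zero_add, sub_zero, hN]
    ring
  have hHc : ContinuousAt (returnHeightSq a e D) 0 :=
    (differentiableAt_returnHeightSq (by simpa using ha)).continuousAt
  have hSc : ContinuousAt (fun d => -Real.log √(returnHeightSq a e D d)) 0 := by
    refine ContinuousAt.neg (ContinuousAt.log hHc.sqrt ?_)
    rw [hH0, Real.sqrt_sq (Real.exp_pos _).le]
    exact (Real.exp_pos _).ne'
  have hS0 : -Real.log √(returnHeightSq a e D 0) = s₀ := by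
    rw [hH0, Real.sqrt_sq (Real.exp_pos _).le, Real.log_exp, neg_neg]
  have hpos : ∀ᶠ d in 𝓝 0, 0 < returnHeightSq a e D d :=
    hHc.eventually_const_lt (by rw [hH0]; positivity)
  have had : ∀ᶠ d in 𝓝 (0 : ℝ), a - d ≠ 0 :=
    ContinuousAt.eventually_ne (by fun_prop) (by simpa using ha)
  -- The return point lies inside the isometric circle, so `γ` raises it: the first visit precedes
  -- the return.
  have hDlt : ∀ᶠ d in 𝓝 (0 : ℝ), (d + e) ^ 2 + returnHeightSq a e D d < |D| := by
    have hc : ContinuousAt (fun d => (d + e) ^ 2 + returnHeightSq a e D d) 0 := by fun_prop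
    refine hc.eventually_lt_const ?_
    simpa only [hH0, zero_add] using hlt
  have huniq : ∀ᶠ d in 𝓝 (0 : ℝ), ∀ t, (ProjGenLinGroup.mk (inversionMat a e D hD) •
      verticalGeodesic d t).re = d → t = -Real.log √(returnHeightSq a e D d) := by
    filter_upwards [had] with d hd t ht
    rw [pglMk_smul] at ht
    have := (inversionMat_smul_re_eq_self_iff (z := verticalGeodesic d t) hd).1 ht
    rw [verticalGeodesic_re, verticalGeodesic_im] at this
    rw [← this, Real.sqrt_sq (Real.exp_pos _).le, Real.log_exp, neg_neg]
  filter_upwards [h.eventually_injOn hb hT hγ (by rw [pglMk_smul, hmeet]) hSc hS0 huniq, hpos,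
    had, hDlt] with d hinj hp hd hDd
  set z := inversionMat a e D hD • returnPoint a e D d with hz
  have him0 := returnPoint_im hp
  have hre : z.re = d := by
    refine (inversionMat_smul_re_eq_self_iff (z := returnPoint a e D d) hd).2 ?_
    rw [him0, Real.sq_sqrt hp.le]
    rfl
  have hzv : z = verticalGeodesic d (-Real.log z.im) := by
    conv_lhs => rw [eq_verticalGeodesic z, hre]
  have hsq : 0 < √(returnHeightSq a e D d) := Real.sqrt_pos.2 hp
  refine ⟨-Real.log z.im, ?_, ?_, hinj⟩
  · rw [neg_lt_neg_iff]
    refine Real.log_lt_log hsq ?_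
    rw [hz, inversionMat_smul_im, him0, Real.sq_sqrt hp.le, lt_div_iff₀ (by
      have := sq_nonneg ((returnPoint a e D d).re + e); linarith), mul_comm]
    exact mul_lt_mul_of_pos_right hDd hsq
  · rw [← hzv]
    exact F.proj_eq_iff.2 ⟨_, hγ, by rw [pglMk_smul]; rfl⟩

/-- This forces any lift of the honda path to agree with the return points on `(-ε, ε)`. -/
theorem FirstSelfIntersection.end_eq {c : ℝ → ℍ} {r s r' s' : ℝ}
    (h : F.FirstSelfIntersection c r s) (h' : F.FirstSelfIntersection c r' s') : s = s' := by
  have key : ∀ {r s r' s' : ℝ}, F.FirstSelfIntersection c r s →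
      F.FirstSelfIntersection c r' s' → ¬ s < s' := fun h h' hlt =>
    h.lt.ne (h'.simple_before (h.lt.trans hlt) hlt h.meets)
  exact le_antisymm (not_lt.1 (key h' h)) (not_lt.1 (key h h'))

end HyperbolicSurface

/-! ### Tangent geodesics and half-discs. -/

theorem coe_verticalGeodesic (x t : ℝ) :
    (verticalGeodesic x t : ℂ) = x + Real.exp (-t) * Complex.I := Complex.mk_eq_add_mul_I _ _

theorem dist_verticalGeodesic (x s t : ℝ) :
    dist (verticalGeodesic x s) (verticalGeodesic x t) = |s - t| := by
  have := (isometry_vertical_line x).dist_eq (-s) (-t)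
  rw [Real.dist_eq, neg_sub_neg, abs_sub_comm] at this
  exact this

theorem hasDerivAt_verticalGeodesic :
    HasDerivAt (fun t => (verticalGeodesic 0 t : ℂ)) (-Complex.I) 0 := by
  simp only [coe_verticalGeodesic]
  have h : HasDerivAt (fun t : ℝ => Real.exp (-t)) (-1) 0 := by
    simpa using (hasDerivAt_neg (0 : ℝ)).exp
  simpa using (h.ofReal_comp.mul_const Complex.I).const_add ((0 : ℝ) : ℂ)

/-- A path with nonzero velocity has a tangent geodesic. -/
theorem exists_isTangentGeodesic {z : ℝ → ℍ} {v : ℂ} (hv : v ≠ 0)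
    (h : HasDerivAt (fun d => (z d : ℂ)) v 0) : ∃ τ, IsTangentGeodesic τ z := by
  -- The rotation about `i` with entries from `u` turns directions by `u / ū`, the direction of
  -- `u²`; since `v = -i u²`, it turns the downward direction `-i` into that of `v`.
  obtain ⟨u, hu⟩ := IsAlgClosed.exists_pow_nat_eq (Complex.I * v) two_pos
  have hu0 : u ≠ 0 := by
    rintro rfl
    simp [hv] at hu
  have hn : 0 < Complex.normSq u := Complex.normSq_pos.2 hu0
  have hn' : 0 < u.re * u.re + u.im * u.im := hn
  set R : GL (Fin 2) ℝ := .mkOfDetNeZero !![u.re, u.im; -u.im, u.re] (by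
    simpa [Matrix.det_fin_two] using hn'.ne') with hR
  set y := (z 0).im with hy
  have hy0 : 0 < y := (z 0).im_pos
  set g := affineMat y (z 0).re hy0.ne' * R with hg
  have hRdet : R.det.val = Complex.normSq u := by
    simp [hR, GeneralLinearGroup.val_det_apply, Matrix.det_fin_two, Complex.normSq_apply]
  have hgdet : g.det.val = y * Complex.normSq u := by
    rw [hg, map_mul, Units.val_mul, hRdet]
    simp [affineMat, GeneralLinearGroup.val_det_apply, Matrix.det_fin_two]
  have hRI : R • verticalGeodesic 0 0 = verticalGeodesic 0 0 := by
    apply UpperHalfPlane.ext_re_im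
    · rw [re_smul_eq_div_normSq]
      simp [hR]
      ring
    · rw [im_smul_eq_div_normSq, normSq_denom_eq, hRdet, abs_of_pos hn, Complex.normSq_apply]
      simp [hR]
      rw [div_eq_one_iff_eq (by nlinarith)]
      ring
  have hden : denom g (verticalGeodesic 0 0) = (starRingEnd ℂ) u := by
    rw [coe_verticalGeodesic]
    apply Complex.ext <;> simp [denom, hg, hR, affineMat, Matrix.mul_apply]
  have hubar : (starRingEnd ℂ) u ≠ 0 := by simpa using hu0
  refine ⟨fun t => g • verticalGeodesic 0 t, ⟨g, fun _ => rfl⟩, ?_, v, hv, h,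
    y / Complex.normSq u, (div_pos hy0 hn).ne', ?_⟩
  · simp only [hg, mul_smul, hRI]
    apply UpperHalfPlane.ext_re_im
    · simp [affineMat_smul_re]
    · rw [affineMat_smul_im, abs_of_pos hy0]
      simp [hy]
  · have hgpos : 0 < g.det.val := by rw [hgdet]; positivity
    simp only [coe_smul_of_det_pos hgpos]
    have h1 : HasDerivAt (fun t => num g (verticalGeodesic 0 t)) (g 0 0 * -Complex.I) 0 :=
      (hasDerivAt_verticalGeodesic.const_mul _).add_const _
    have h2 : HasDerivAt (fun t => denom g (verticalGeodesic 0 t)) (g 1 0 * -Complex.I) 0 :=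
      (hasDerivAt_verticalGeodesic.const_mul _).add_const _
    convert! h1.div h2 (denom_ne_zero g _) using 1
    have h3 : g 0 0 * -Complex.I * denom g (verticalGeodesic 0 0)
        - num g (verticalGeodesic 0 0) * (g 1 0 * -Complex.I) = g.det.val * -Complex.I := by
      simp only [num, denom, GeneralLinearGroup.val_det_apply, Matrix.det_fin_two]
      push_cast
      ring
    have h4 : (Complex.normSq u : ℂ) = u * (starRingEnd ℂ) u := (Complex.mul_conj u).symm
    have h5 : v = -Complex.I * u ^ 2 := by
      rw [hu, ← mul_assoc, neg_mul, Complex.I_mul_I, neg_neg, one_mul]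
    rw [h3, hden, hgdet]
    push_cast
    rw [h4, h5]
    field_simp

/-- The half of the ball about `i` on one side of the imaginary axis. -/
def halfBall (c ρ : ℝ) : Set ℍ := Metric.ball (verticalGeodesic 0 0) ρ ∩ {w | 0 < c * w.re}

theorem isOpen_halfBall (c ρ : ℝ) : IsOpen (halfBall c ρ) :=
  Metric.isOpen_ball.inter (isOpen_lt continuous_const (continuous_const.mul continuous_re))

theorem isConnected_halfBall {c ρ : ℝ} (hc : c ≠ 0) (hρ : 0 < ρ) : IsConnected (halfBall c ρ) := by
  constructor
  · have hcont : Continuous fun x => verticalGeodesic x 0 :=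
      continuous_verticalGeodesic.comp (by fun_prop : Continuous fun x : ℝ => (x, (0 : ℝ)))
    have hx : ∀ᶠ x in 𝓝 (0 : ℝ), verticalGeodesic x 0 ∈ Metric.ball (verticalGeodesic 0 0) ρ :=
      hcont.continuousAt.eventually (Metric.ball_mem_nhds _ hρ)
    obtain ⟨δ, hδ, hball⟩ := Metric.eventually_nhds_iff.1 hx
    have hc' : 0 < |c| := abs_pos.2 hc
    refine ⟨verticalGeodesic (δ / 2 * (c / |c|)) 0, hball ?_, ?_⟩
    · rw [Real.dist_eq, sub_zero, abs_mul, abs_div c, abs_abs, div_self hc'.ne', mul_one,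
        abs_of_pos (by positivity)]
      linarith
    · rw [Set.mem_ofPred_eq, verticalGeodesic_re]
      have : c * (δ / 2 * (c / |c|)) = δ / 2 * (c ^ 2 / |c|) := by ring
      rw [this]
      positivity
  -- A hyperbolic ball is a Euclidean ball, so the half ball is convex in `ℂ`.
  · rw [← isEmbedding_coe.isInducing.isPreconnected_image]
    have : ((↑) : ℍ → ℂ) '' halfBall c ρ = ((↑) '' Metric.ball (verticalGeodesic 0 0) ρ)
        ∩ {w : ℂ | 0 < c * w.re} := by
      ext w
      constructor
      · rintro ⟨x, hx, rfl⟩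
        exact ⟨⟨x, hx.1, rfl⟩, hx.2⟩
      · rintro ⟨⟨x, hx, rfl⟩, hw⟩
        exact ⟨x, ⟨hx, hw⟩, rfl⟩
    rw [this, image_coe_ball]
    refine ((convex_ball _ _).inter ?_).isPreconnected
    exact convex_halfSpace_gt (f := fun w : ℂ => c * w.re)
      ⟨fun x y => by simp [mul_add], fun r x => by simp; ring⟩ 0

namespace HyperbolicSurface

/-- A diameter of a small disc separates it into two half discs. -/
theorem separatesInto_disc (F : HyperbolicSurface) (h : GL (Fin 2) ℝ) {c ρ : ℝ} (hc : c ≠ 0)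
    (hρ : 0 < ρ) (hinj : ∀ γ ∈ F.Γ, ∀ z ∈ Metric.ball (h • verticalGeodesic 0 0) ρ,
      γ • z ∈ Metric.ball (h • verticalGeodesic 0 0) ρ → γ = 1) :
    SeparatesInto ((fun t => F.proj (h • verticalGeodesic 0 t)) '' Ioo (-ρ) ρ)
      (F.disc (h • verticalGeodesic 0 0) ρ) ((fun w => F.proj (h • w)) '' halfBall c ρ)
      ((fun w => F.proj (h • w)) '' halfBall (-c) ρ) := by
  have hcont : Continuous fun w : ℍ => F.proj (h • w) :=
    F.continuous_proj.comp (continuous_const_smul h)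
  have hopen : IsOpenMap fun w : ℍ => F.proj (h • w) :=
    F.isOpenMap_proj.comp (isOpenMap_smul h)
  have hinj' : InjOn (fun w : ℍ => F.proj (h • w)) (Metric.ball (verticalGeodesic 0 0) ρ) := by
    intro x hx y hy hxy
    obtain ⟨γ, hγ, hγy⟩ := F.proj_eq_iff.1 hxy
    have hb : ∀ w ∈ Metric.ball (verticalGeodesic 0 0) ρ,
        h • w ∈ Metric.ball (h • verticalGeodesic 0 0) ρ := fun w hw => by
      rw [← smul_ball_gl]; exact mem_image_of_mem _ hw
    have h1 := hinj γ hγ _ (hb y hy) (hγy ▸ hb x hx)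
    rw [h1, one_smul] at hγy
    exact (MulAction.injective h hγy).symm
  have hvert : ∀ t, verticalGeodesic 0 t ∈ Metric.ball (verticalGeodesic 0 0) ρ ↔
      t ∈ Ioo (-ρ) ρ := fun t => by
    rw [Metric.mem_ball, dist_verticalGeodesic, sub_zero, abs_lt, mem_Ioo]
  have hside : ∀ w ∈ Metric.ball (verticalGeodesic 0 0) ρ, w.re ≠ 0 →
      w ∈ halfBall c ρ ∪ halfBall (-c) ρ := fun w hw hre => by
    rcases (mul_ne_zero hc hre).lt_or_gt with hlt | hlt
    · exact .inr ⟨hw, by simpa using hlt⟩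
    · exact .inl ⟨hw, hlt⟩
  refine ⟨hopen _ (isOpen_halfBall _ _), hopen _ (isOpen_halfBall _ _),
    (isConnected_halfBall hc hρ).image _ hcont.continuousOn,
    (isConnected_halfBall (neg_ne_zero.2 hc) hρ).image _ hcont.continuousOn, ?_, ?_⟩
  · rw [Set.disjoint_left]
    rintro _ ⟨x, hx, rfl⟩ ⟨y, hy, hxy⟩
    have := hinj' hy.1 hx.1 hxy
    subst this
    have h1 : 0 < c * y.re := hx.2
    have h2 : 0 < -c * y.re := hy.2
    linarith
  · rw [disc, ← smul_ball_gl, image_image, ← image_union]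
    ext p
    constructor
    · rintro ⟨w, hw, rfl⟩
      have hwb : w ∈ Metric.ball (verticalGeodesic 0 0) ρ := by
        rcases hw with hw | hw <;> exact hw.1
      refine ⟨mem_image_of_mem _ hwb, ?_⟩
      rintro ⟨t, ht, htw⟩
      have := hinj' ((hvert t).2 ht) hwb htw
      subst this
      rcases hw with hw | hw <;> simpa using hw.2
    · rintro ⟨⟨w, hw, rfl⟩, hnot⟩
      refine mem_image_of_mem _ (hside w hw fun hre => hnot ?_)
      have hwv : w = verticalGeodesic 0 (-Real.log w.im) := by
        conv_lhs => rw [eq_verticalGeodesic w, hre]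
      refine ⟨_, (hvert _).1 (hwv ▸ hw), ?_⟩
      simp only [← hwv]

end HyperbolicSurface

/-! ### The sides of the tangent geodesic. -/

theorem exists_hasDerivAt_returnPoint {a e D : ℝ} (ha : a ≠ 0) (h : 0 < returnHeightSq a e D 0) :
    ∃ v : ℂ, v ≠ 0 ∧ HasDerivAt (fun d => (returnPoint a e D d : ℂ)) v 0 := by
  have hH := differentiableAt_returnHeightSq (a := a) (e := e) (D := D) (d := 0) (by simpa using ha)
  have hy : DifferentiableAt ℝ (fun d => Real.exp (-(-Real.log √(returnHeightSq a e D d)))) 0 :=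
    (((hH.sqrt h.ne').log (Real.sqrt_pos.2 h).ne').neg.neg).exp
  obtain ⟨y', hy'⟩ : ∃ y', HasDerivAt _ y' 0 := ⟨_, hy.hasDerivAt⟩
  refine ⟨1 + y' * Complex.I, fun h0 => ?_, ?_⟩
  · simpa using congrArg Complex.re h0
  · simp only [returnPoint, coe_verticalGeodesic]
    exact (hasDerivAt_id (0 : ℝ)).ofReal_comp.add (hy'.ofReal_comp.mul_const Complex.I)

/-- Along the curve `|w|² = d² + returnHeightSq a e D d`, where the `d²` terms cancel; no square
root is left in the signed side function. -/
theorem re_smul_returnPoint_mul (M : GL (Fin 2) ℝ) {a e D d : ℝ} (h : 0 < returnHeightSq a e D d) :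
    (M • returnPoint a e D d).re * ((M 1 0 * d + M 1 1) ^ 2 + M 1 0 ^ 2 * returnHeightSq a e D d)
      = M 0 0 * M 1 0 * (D * (d + e) / (a - d) - 2 * d * e - e ^ 2)
        + (M 0 0 * M 1 1 + M 0 1 * M 1 0) * d + M 0 1 * M 1 1 := by
  have hd := normSq_denom_eq M (returnPoint a e D d)
  have hd0 := normSq_denom_pos M (returnPoint a e D d).im_ne_zero
  have hre : (returnPoint a e D d).re = d := rfl
  rw [returnPoint_im h, hre, mul_pow, Real.sq_sqrt h.le] at hd
  rw [re_smul_eq_div_normSq, ← hd, div_mul_cancel₀ _ hd0.ne', hre, returnPoint_im h,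
    Real.sq_sqrt h.le, returnHeightSq]
  ring

/-- If `M` takes the curve of return points to a curve tangent to the imaginary axis, the two
quadratic relations between the coefficients hold. -/
theorem returnPoint_tangency (M : GL (Fin 2) ℝ) {a e D : ℝ} (ha : a ≠ 0)
    (hH : 0 < returnHeightSq a e D 0) (h0 : (M • returnPoint a e D 0).re = 0)
    (h1 : HasDerivAt (fun d => (M • returnPoint a e D d).re) 0 0) :
    M 0 0 * M 1 0 * (D * e / a - e ^ 2) + M 0 1 * M 1 1 = 0 ∧
    M 0 0 * M 1 0 * (D * (a + e) / a ^ 2 - 2 * e) + (M 0 0 * M 1 1 + M 0 1 * M 1 0) = 0 := by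
  constructor
  · have := re_smul_returnPoint_mul M hH
    rw [h0] at this
    simp only [zero_add, sub_zero, mul_zero, zero_mul] at this
    linarith
  · have hHd := differentiableAt_returnHeightSq (a := a) (e := e) (D := D) (d := 0) (by simpa using ha)
    have hn : DifferentiableAt ℝ (fun d => (M 1 0 * d + M 1 1) ^ 2
        + M 1 0 ^ 2 * returnHeightSq a e D d) 0 := by fun_prop
    have h2 := h1.mul hn.hasDerivAt
    rw [h0, zero_mul, zero_mul, add_zero] at h2
    have hq : HasDerivAt (fun d => D * (d + e) / (a - d)) (D * (a + e) / a ^ 2) 0 := by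
      have hnum : HasDerivAt (fun d : ℝ => D * (d + e)) D 0 := by
        simpa using ((hasDerivAt_id (0 : ℝ)).add_const e).const_mul D
      have hden : HasDerivAt (fun d : ℝ => a - d) (-1) 0 := (hasDerivAt_id (0 : ℝ)).const_sub a
      convert! hnum.div hden (by simpa using ha) using 1
      simp only [sub_zero, zero_add]
      ring
    have hG : HasDerivAt (fun d => M 0 0 * M 1 0 * (D * (d + e) / (a - d) - 2 * d * e - e ^ 2)
        + (M 0 0 * M 1 1 + M 0 1 * M 1 0) * d + M 0 1 * M 1 1)
        (M 0 0 * M 1 0 * (D * (a + e) / a ^ 2 - 2 * e) + (M 0 0 * M 1 1 + M 0 1 * M 1 0)) 0 := by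
      have hl : HasDerivAt (fun d : ℝ => 2 * d * e) (2 * e) 0 := by
        simpa using ((hasDerivAt_id (0 : ℝ)).const_mul 2).mul_const e
      have hl' : HasDerivAt (fun d : ℝ => (M 0 0 * M 1 1 + M 0 1 * M 1 0) * d)
          (M 0 0 * M 1 1 + M 0 1 * M 1 0) 0 := by
        simpa using (hasDerivAt_id (0 : ℝ)).const_mul (M 0 0 * M 1 1 + M 0 1 * M 1 0)
      exact ((((hq.sub hl).sub_const _).const_mul _).add hl').add_const _
    refine hG.unique (h2.congr_of_eventuallyEq ?_)
    filter_upwards [hHd.continuousAt.eventually_const_lt hH] with d hd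
    exact (re_smul_returnPoint_mul M hd).symm

/-- The tangent geodesic is not a vertical line: otherwise both `p` and `q` vanish in its equation,
while `q² - 4pm = det²`. -/
theorem mul_ne_zero_of_tangency (M : GL (Fin 2) ℝ) {B : ℝ}
    (h1 : M 0 0 * M 1 0 * B + (M 0 0 * M 1 1 + M 0 1 * M 1 0) = 0) : M 0 0 * M 1 0 ≠ 0 := by
  intro h
  have hdet := M.det.ne_zero
  rw [GeneralLinearGroup.val_det_apply, Matrix.det_fin_two] at hdet
  rw [h, zero_mul, zero_add] at h1
  refine hdet (pow_eq_zero_iff two_ne_zero |>.1 ?_)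
  linear_combination (M 0 0 * M 1 1 + M 0 1 * M 1 0) * h1 - 4 * (M 0 1 * M 1 1) * h

/-- The curve of return points stays on one side of its tangent geodesic. -/
theorem returnPoint_side (M : GL (Fin 2) ℝ) {a e D d : ℝ} (ha : a ≠ 0) (hd : d ≠ 0) (hD : D ≠ 0)
    (had : 0 < (a + e) / (a - d)) (hH : 0 < returnHeightSq a e D d)
    (h0 : M 0 0 * M 1 0 * (D * e / a - e ^ 2) + M 0 1 * M 1 1 = 0)
    (h1 : M 0 0 * M 1 0 * (D * (a + e) / a ^ 2 - 2 * e) + (M 0 0 * M 1 1 + M 0 1 * M 1 0) = 0) :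
    0 < M 0 0 * M 1 0 * D * (M • returnPoint a e D d).re := by
  have hne : a - d ≠ 0 := by
    intro h
    simp [h] at had
  have hpu := mul_ne_zero_of_tangency M h1
  have key := re_smul_returnPoint_mul M hH
  have hrhs : M 0 0 * M 1 0 * (D * (d + e) / (a - d) - 2 * d * e - e ^ 2)
        + (M 0 0 * M 1 1 + M 0 1 * M 1 0) * d + M 0 1 * M 1 1
        = M 0 0 * M 1 0 * D * ((a + e) / (a - d)) * (d / a) ^ 2 := by
    -- Exact first-order Taylor expansion at `0`. Tangency cancels the affine part, and only the
    -- remainder, of constant sign, is left.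
    have hq : D * (d + e) / (a - d) = D * e / a + D * (a + e) / a ^ 2 * d
        + D * ((a + e) / (a - d)) * (d / a) ^ 2 := by
      field_simp
      ring
    rw [hq]
    linear_combination h0 + d * h1
  have hn : 0 < (M 1 0 * d + M 1 1) ^ 2 + M 1 0 ^ 2 * returnHeightSq a e D d := by
    have h := normSq_denom_pos M (returnPoint a e D d).im_ne_zero
    rw [normSq_denom_eq, returnPoint_im hH, mul_pow, Real.sq_sqrt hH.le] at h
    exact h
  rw [hrhs] at key
  have hpos : 0 < M 0 0 * M 1 0 * D * (M 0 0 * M 1 0 * D * ((a + e) / (a - d)) * (d / a) ^ 2) := by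
    have h2 : 0 < (M 0 0 * M 1 0 * D) ^ 2 := by
      have := mul_ne_zero hpu hD
      positivity
    have h3 : 0 < (d / a) ^ 2 := by
      have := div_ne_zero hd ha
      positivity
    have := mul_pos (mul_pos h2 had) h3
    linarith
  rw [← key, ← mul_assoc] at hpos
  exact pos_of_mul_pos_left hpos hn.le

theorem sq_inversionMat_smul_im {a e D : ℝ} {hD : D ≠ 0} {w : ℍ}
    (h : (inversionMat a e D hD • w).re = 0) :
    (inversionMat a e D hD • w).im ^ 2 = D ^ 2 / ((w.re + e) ^ 2 + w.im ^ 2) - a ^ 2 := by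
  have hN : 0 < (w.re + e) ^ 2 + w.im ^ 2 := by have := w.im_pos; positivity
  rw [inversionMat_smul_re, sub_eq_zero] at h
  rw [inversionMat_smul_im, h, div_pow, mul_pow, sq_abs]
  field_simp
  ring

/-- The preimage of the part of the imaginary axis above the first visit stays on one side of the
tangent geodesic of the curve of return points. -/
theorem ray_side (M : GL (Fin 2) ℝ) {a e D : ℝ} {hD : D ≠ 0} {w w₀ : ℍ} (ha : a ≠ 0)
    (hw₀ : w₀.re = 0) (hr₀ : (inversionMat a e D hD • w₀).re = 0)
    (hr : (inversionMat a e D hD • w).re = 0)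
    (hlt : (inversionMat a e D hD • w₀).im < (inversionMat a e D hD • w).im)
    (h0 : M 0 0 * M 1 0 * (D * e / a - e ^ 2) + M 0 1 * M 1 1 = 0)
    (h1 : M 0 0 * M 1 0 * (D * (a + e) / a ^ 2 - 2 * e) + (M 0 0 * M 1 1 + M 0 1 * M 1 0) = 0) :
    0 < M 0 0 * M 1 0 * D * (M • w).re := by
  have hpu := mul_ne_zero_of_tangency M h1
  have hN : 0 < (w.re + e) ^ 2 + w.im ^ 2 := by have := w.im_pos; positivity
  have hN₀ : 0 < (w₀.re + e) ^ 2 + w₀.im ^ 2 := by have := w₀.im_pos; positivity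
  have hsq := pow_lt_pow_left₀ hlt (inversionMat a e D hD • w₀).im_pos.le two_ne_zero
  rw [sq_inversionMat_smul_im hr₀, sq_inversionMat_smul_im hr, sub_lt_sub_iff_right,
    div_lt_div_iff_of_pos_left (by positivity) hN₀ hN] at hsq
  rw [inversionMat_smul_re, sub_eq_zero, eq_div_iff hN.ne'] at hr
  rw [inversionMat_smul_re, sub_eq_zero, eq_div_iff hN₀.ne', hw₀, zero_add] at hr₀
  rw [hw₀, zero_add] at hsq hN₀
  -- Being sent higher on the axis means being closer to `-e`, and along the preimage of the axis
  -- the squared distance to `-e` is affine in `w.re`; this fixes the sign of `w.re`.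
  have hx : 0 < -(D * e * (D * w.re)) := by
    have h2 : D * e * (D * w.re)
        = a ^ 2 * (e ^ 2 + w₀.im ^ 2) * (((w.re + e) ^ 2 + w.im ^ 2) - (e ^ 2 + w₀.im ^ 2)) := by
      linear_combination -(D * w.re) * hr₀ - a * (e ^ 2 + w₀.im ^ 2) * (hr - hr₀)
    have h3 : 0 < a ^ 2 * (e ^ 2 + w₀.im ^ 2) := by positivity
    rw [h2]
    nlinarith [mul_pos h3 (sub_pos.2 hsq)]
  have hn := normSq_denom_pos M w.im_ne_zero
  have key : (M • w).re * Complex.normSq (denom M w)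
      = -(M 0 0 * M 1 0 * D * e * w.re / a ^ 2) := by
    rw [re_smul_eq_div_normSq, div_mul_cancel₀ _ hn.ne']
    -- The equation of the preimage of the axis, a line in the coordinates `(x, |w|²)` meeting the
    -- tangent line at `x = 0`.
    have hN' : w.re ^ 2 + w.im ^ 2 = D * (w.re + e) / a - 2 * w.re * e - e ^ 2 := by
      rw [← hr]
      field_simp
      ring
    rw [hN']
    have hq : D * (a + e) / a ^ 2 = D / a + D * e / a ^ 2 := by field_simp
    rw [hq] at h1
    linear_combination h0 + w.re * h1
  have hpos : 0 < M 0 0 * M 1 0 * D * (-(M 0 0 * M 1 0 * D * e * w.re / a ^ 2)) := by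
    have h4 : M 0 0 * M 1 0 * D * (-(M 0 0 * M 1 0 * D * e * w.re / a ^ 2))
        = (M 0 0 * M 1 0 / a) ^ 2 * -(D * e * (D * w.re)) := by ring
    rw [h4]
    have := div_ne_zero hpu ha
    positivity
  rw [← key, ← mul_assoc] at hpos
  exact pos_of_mul_pos_left hpos hn.le

/-! ### Assembly on the surface. -/

theorem lemma4p1 (F : HyperbolicSurface) (hF : F.IsFiniteType) (σ : F.Lasso) :
    ∀ᶠ ε in 𝓝[>] (0 : ℝ),
      (∃ z : ℝ → ℍ, σ.IsHondaPathLift ε z) ∧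
      ∀ z : ℝ → ℍ, σ.IsHondaPathLift ε z →
        z 0 = σ.hondaLift ∧
        (∃ τ : ℝ → ℍ, IsTangentGeodesic τ z) ∧
        ∀ τ : ℝ → ℍ, IsTangentGeodesic τ z →
          ∀ᶠ ρ in 𝓝[>] (0 : ℝ), ∃ U₁ U₂ : Set F.Point,
            SeparatesInto ((fun t => F.proj (τ t)) '' Set.Ioo (-ρ) ρ)
              (F.disc σ.hondaLift ρ) U₁ U₂ ∧
            (σ.segment ∩ F.disc σ.hondaLift ρ) \ {σ.honda} ⊆ U₁ ∧
            (((fun d => F.proj (z d)) '' Set.Ioo (-ε) ε) ∩ F.disc σ.hondaLift ρ) \ {σ.honda}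
              ⊆ U₁ := by
  obtain ⟨g, hcusp, r₀, s₀, hfirst⟩ := σ
  set σ : F.Lasso := ⟨g, hcusp, r₀, s₀, hfirst⟩
  obtain ⟨b, hb, hT⟩ := F.exists_translation_of_representsCusp hcusp
  have hfirst' := F.conj_firstSelfIntersection_iff.2 hfirst
  obtain ⟨a, e, D, hD, hA, hmeet, ha, -, hN, hlt⟩ := hfirst'.exists_inversionMat hb hT
  have hev := hfirst'.eventually_firstSelfIntersection hb hT hA hmeet ha hN hlt
  have hmeet' : ProjGenLinGroup.mk (inversionMat a e D hD) • verticalGeodesic 0 s₀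
      = verticalGeodesic 0 r₀ := by rw [pglMk_smul, hmeet]
  obtain ⟨ρ₁, hρ₁, hray⟩ := hfirst'.exists_pos_forall_dist_lt hb hT hA hmeet'
  obtain ⟨η, hη, hinj⟩ := F.exists_pos_forall_eq_one (g • verticalGeodesic 0 s₀)
  have hH0 : returnHeightSq a e D 0 = Real.exp (-s₀) ^ 2 := by
    simp only [returnHeightSq, zero_add, sub_zero, hN]
    ring
  have hHpos : 0 < returnHeightSq a e D 0 := by rw [hH0]; positivity
  have hζ0 : returnPoint a e D 0 = verticalGeodesic 0 s₀ := by
    rw [returnPoint, hH0, Real.sqrt_sq (Real.exp_pos _).le, Real.log_exp, neg_neg]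
  obtain ⟨v, hv, hζ⟩ := exists_hasDerivAt_returnPoint ha hHpos
  obtain ⟨A, hAinj, hAd⟩ := exists_hasDerivAt_smul g (returnPoint a e D 0)
  have hgζ := hAd (returnPoint a e D) 0 v rfl hζ
  -- Since `γ` raises the honda lift, `|D e / a| < |D|`, so `|e| < |a|`.
  have hae : 0 < (a + e) / a := by
    have h1 : |D * e / a| < |D| := by rwa [hN, abs_of_pos (by positivity)]
    rw [mul_div_assoc, abs_mul] at h1
    have h2 : |e / a| < 1 := by
      have := abs_pos.2 hD
      by_contra! h
      nlinarith
    rw [add_div, div_self ha]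
    linarith [(abs_lt.1 h2).1]
  have hHc : ContinuousAt (returnHeightSq a e D) 0 :=
    (differentiableAt_returnHeightSq (by simpa using ha)).continuousAt
  have hgood : ∀ᶠ d in 𝓝 (0 : ℝ),
      (∃ r, (F.conj g).FirstSelfIntersection (verticalGeodesic d) r
        (-Real.log √(returnHeightSq a e D d))) ∧
      0 < returnHeightSq a e D d ∧ 0 < (a + e) / (a - d) ∧
      g • returnPoint a e D d ∈ Metric.ball (g • verticalGeodesic 0 s₀) η := by
    refine hev.and ((hHc.eventually_const_lt hHpos).and (.and ?_ ?_))
    · have hc : ContinuousAt (fun d => (a + e) / (a - d)) 0 :=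
        ContinuousAt.div (by fun_prop) (by fun_prop) (by simpa using ha)
      exact hc.eventually_const_lt (by simpa using hae)
    · have hc : ContinuousAt (fun d => g • returnPoint a e D d) 0 :=
        isEmbedding_coe.continuousAt_iff.2 hgζ.continuousAt
      exact hc.eventually (Metric.isOpen_ball.mem_nhds (by
        simpa only [hζ0] using Metric.mem_ball_self hη))
  obtain ⟨ε₀, hε₀, hgood⟩ := Metric.eventually_nhds_iff.1 hgood
  filter_upwards [Ioo_mem_nhdsGT hε₀] with ε hε
  replace hgood : ∀ d ∈ Ioo (-ε) ε, _ := fun d hd => hgood (y := d) (by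
    rw [Real.dist_eq, sub_zero]
    exact (abs_lt.2 hd).trans hε.2)
  refine ⟨⟨fun d => g • returnPoint a e D d, fun d hd => ?_⟩, fun z hz => ?_⟩
  · obtain ⟨r, hr⟩ := (hgood d hd).1
    exact ⟨r, _, F.conj_firstSelfIntersection_iff.1 hr, rfl⟩
  have hzeq : ∀ d ∈ Ioo (-ε) ε, z d = g • returnPoint a e D d := by
    intro d hd
    obtain ⟨r, s, hrs, hzd⟩ := hz d hd
    obtain ⟨r', hr'⟩ := (hgood d hd).1
    rw [hzd, hrs.end_eq (F.conj_firstSelfIntersection_iff.1 hr')]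
    rfl
  have h0mem : (0 : ℝ) ∈ Ioo (-ε) ε := ⟨neg_lt_zero.2 hε.1, hε.1⟩
  have hz0 : z 0 = g • verticalGeodesic 0 s₀ := by rw [hzeq 0 h0mem, hζ0]
  have hzev : ∀ᶠ d in 𝓝 (0 : ℝ), z d = g • returnPoint a e D d :=
    eventually_of_mem (isOpen_Ioo.mem_nhds h0mem) hzeq
  have hzd : HasDerivAt (fun d => (z d : ℂ)) (A v) 0 :=
    hgζ.congr_of_eventuallyEq (hzev.mono fun d hd => congrArg UpperHalfPlane.coe hd)
  refine ⟨hz0, exists_isTangentGeodesic ?_ hzd, ?_⟩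
  · rwa [Ne, ← map_zero A, hAinj.eq_iff]
  rintro τ ⟨⟨h, hτ⟩, hτ0, w, -, hw, k, hk, hkw⟩
  have hh0 : h • verticalGeodesic 0 0 = g • verticalGeodesic 0 s₀ := by rw [← hτ, hτ0, hz0]
  obtain ⟨B, -, hB⟩ := exists_hasDerivAt_smul h⁻¹ (z 0)
  have hBz := hB z 0 w rfl hw
  have hBτ := hB τ 0 (k * w) hτ0 hkw
  simp only [hτ, inv_smul_smul] at hBτ
  have hBw : (B w).re = 0 := by
    have h1 := hBτ.unique hasDerivAt_verticalGeodesic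
    rw [← Complex.real_smul, map_smul] at h1
    have h2 := congrArg Complex.re h1
    simpa [hk] using h2
  -- `M` goes from the coordinates with the cusp at `∞` to those in which the tangent geodesic is
  -- the imaginary axis.
  set M := h⁻¹ * g
  have hM : ∀ x : ℍ, h⁻¹ • g • x = M • x := fun x => (mul_smul _ _ _).symm
  have hMre : HasDerivAt (fun d => (M • returnPoint a e D d).re) 0 0 := by
    have h1 := Complex.reCLM.hasFDerivAt.comp_hasDerivAt (0 : ℝ) hBz
    rw [Complex.reCLM_apply, hBw] at h1
    refine h1.congr_of_eventuallyEq (hzev.mono fun d hd => ?_)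
    simp only [Function.comp_apply, hd, hM]
    rfl
  have hM0 : (M • returnPoint a e D 0).re = 0 := by
    rw [hζ0, ← hM, ← hh0, inv_smul_smul, verticalGeodesic_re]
  obtain ⟨hq0, hq1⟩ := returnPoint_tangency M ha hHpos hM0 hMre
  have hpu := mul_ne_zero_of_tangency M hq1
  set c := M 0 0 * M 1 0 * D
  have hc : c ≠ 0 := mul_ne_zero hpu hD
  -- Below `η` the disc lifts injectively; below `ρ₁` only the translate of the segment by `γ⁻¹`
  -- enters it.
  filter_upwards [Ioo_mem_nhdsGT (lt_min hη hρ₁)] with ρ hρ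
  have hρη : ρ < η := hρ.2.trans_le (min_le_left _ _)
  have hhalf : ∀ x : ℍ, g • x ∈ Metric.ball (g • verticalGeodesic 0 s₀) ρ → 0 < c * (M • x).re →
      F.proj (g • x) ∈ (fun w => F.proj (h • w)) '' halfBall c ρ := by
    intro x hx hcx
    refine ⟨M • x, ⟨?_, hcx⟩, by simp only [← hM, smul_inv_smul]⟩
    rw [← hh0, ← smul_ball_gl] at hx
    obtain ⟨y, hy, hyx⟩ := hx
    rw [← hM, ← hyx]
    simpa using hy
  refine ⟨(fun w => F.proj (h • w)) '' halfBall c ρ, (fun w => F.proj (h • w)) '' halfBall (-c) ρ,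
    ?_, ?_, ?_⟩
  · have := F.separatesInto_disc h hc hρ.1 (by
      rw [hh0]
      exact fun γ hγ x hx hx' => hinj γ hγ x (Metric.ball_subset_ball hρη.le hx)
        (Metric.ball_subset_ball hρη.le hx'))
    rw [hh0] at this
    simp only [hτ]
    exact this
  · rintro _ ⟨⟨⟨t, ht, rfl⟩, ⟨x, hx, hxt⟩⟩, hne⟩
    change t ≤ r₀ at ht
    change x ∈ Metric.ball (g • verticalGeodesic 0 s₀) ρ at hx
    change F.proj x = F.proj (g • verticalGeodesic 0 t) at hxt
    have htne : t ≠ r₀ := by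
      rintro rfl
      exact hne hfirst.meets
    obtain ⟨y, rfl⟩ : ∃ y, g • y = x := ⟨g⁻¹ • x, smul_inv_smul g x⟩
    obtain ⟨γ, hγ, hγy⟩ := (F.conj g).proj_eq_iff.1 (F.conj_proj_eq_iff.2 hxt)
    rw [Metric.mem_ball, (isometry_gl_smul g).dist_eq, ← hγy] at hx
    have hγA := hray γ hγ t ht (hx.trans (hρ.2.trans_le (min_le_right _ _)))
    have hAy : inversionMat a e D hD • y = verticalGeodesic 0 t := by
      rw [← hγy, hγA, ← pglMk_smul, smul_inv_smul]
    change F.proj (g • verticalGeodesic 0 t) ∈ _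
    rw [← hxt]
    refine hhalf y ?_ ?_
    · rwa [Metric.mem_ball, (isometry_gl_smul g).dist_eq, ← hγy]
    · refine ray_side (hD := hD) M ha (verticalGeodesic_re 0 s₀) ?_ ?_ ?_ hq0 hq1
      · rw [hmeet, verticalGeodesic_re]
      · rw [hAy, verticalGeodesic_re]
      · rw [hmeet, hAy, verticalGeodesic_im, verticalGeodesic_im, Real.exp_lt_exp, neg_lt_neg_iff]
        exact lt_of_le_of_ne ht htne
  · rintro _ ⟨⟨⟨d, hd, rfl⟩, ⟨x, hx, hxd⟩⟩, hne⟩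
    change x ∈ Metric.ball (g • verticalGeodesic 0 s₀) ρ at hx
    change F.proj x = F.proj (z d) at hxd
    change F.proj (z d) ∈ _
    change ¬ F.proj (z d) = F.proj (g • verticalGeodesic 0 s₀) at hne
    obtain ⟨-, hHd, had, hball⟩ := hgood d hd
    rw [hzeq d hd] at hxd hne ⊢
    have hd0 : d ≠ 0 := by
      rintro rfl
      exact hne (by rw [hζ0])
    obtain ⟨γ, hγ, hγx⟩ := F.proj_eq_iff.1 hxd
    -- The choice of `ε` keeps the whole lifted honda path in the injectivity ball, so no other
    -- translate of it enters the disc.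
    have hγ1 := hinj γ hγ _ hball (by rw [hγx]; exact Metric.ball_subset_ball hρη.le hx)
    rw [hγ1, one_smul] at hγx
    rw [← hγx] at hx
    exact hhalf _ hx (returnPoint_side M ha hd0 hD had hHd hq0 hq1)
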